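/- **Notation.** $\widehat F_2$ is the free profinite group on $x,y$; for $f\in\widehat F_2$ and elements $a,b$ of a profinite group $G$, $f(a,b)\in G$ is the image of $f$ under the continuous homomorphism $x\mapsto a$, $y\mapsto b$; for $\lambda\in\widehat{\mathbb Z}$, $a^\lambda$ is the profinite power; $\mathrm{inn}(g)$ is $u\mapsto gug^{-1}$. $\widehat B_n$ is the profinite completion of the Artin braid group with generators $\sigma_1,\dots,\sigma_{n-1}$. For $1\le i<j\le n$, $T_{i,\dots,j}=(\sigma_i\cdots\sigma_{j-1})^{\,j-i+1}$ is the full twist of the strands $i,\dots,j$. For elements $s_1,\dots,s_{n-1}$ of a profinite group put $\eta_i(s)=s_{i-1}\cdots s_1\cdot s_1\cdots s_{i-1}$ $(i\ge2)$, and $\eta_i=\eta_i(\sigma)$. $\widehat{GT}$ is the profinite Grothendieck–Teichmüller group: the pairs $F=(\lambda,f)$ with $\lambda\in\widehat{\mathbb Z}^\times$ and $f$ in the closed derived subgroup of $\widehat F_2$ such that $x\mapsto x^\lambda$, $y\mapsto f^{-1}y^\lambda f$ is an automorphism of $\widehat F_2$ and - (I) $f(x,y)f(y,x)=1$; - (II)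 $f(x,y)x^mf(z,x)z^mf(y,z)y^m=1$ where $xyz=1$, $m=(\lambda-1)/2$; - (III) $f(T_{12},T_{234})\,f(T_{123},T_{34})=f(T_{23},T_{34})\,f(T_{123},T_{234})\,f(T_{12},T_{23})$ in $\widehat B_4$. An automorphism acts on $s_1,\dots,s_{n-1}$ by the *Drinfeld formulas* for $F$ if it sends $s_1\mapsto s_1^\lambda$ and $s_i\mapsto f(s_i^2,\eta_i(s))\,s_i^\lambda\,f(\eta_i(s),s_i^2)$ for $2\le i\le n-1$. A maximal bracketing of $x_1,\dots,x_n$ is a complete bracketing (planar binary tree), the outermost pair of brackets being omitted; the standard one, $\mathcal B_0$, has brackets around $x_1,\dots,x_i$ for $2\le i\le n-1$. An A-move replaces a configuration $(X_1,X_2),X_3$ by $X_1,(X_2,X_3)$ or vice versa, where each $X_i$ is a single point or a bracketed packet of consecutive points. **Theorem.** Let $F=(\lambda,f)\in\widehat{GT}$. There is a unique family of continuous automorphisms $F_{\mathcal B}$ of $\widehat B_8$, indexed by the maximal bracketings of 8 points, such that $F_{\mathcal B_0}$ acts on $\sigma_1,\dots,\sigma_7$ by the Drinfeld formulas and such that $F_{\mathcal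 B'}=\mathrm{inn}\,f(T_{i,\dots,j},T_{i',\dots,j'})\circ F_{\mathcal B}$ whenever an A-move from $\mathcal B$ to $\mathcal B'$ replaces the brackets around the points $i,\dots,j$ by brackets around the points $i',\dots,j'$. Let $$\mathcal B=(((x_1,x_2),(x_3,x_4)),(x_5,x_6)),(x_7,x_8)$$ and let $\tau_1=\sigma_2\sigma_1\sigma_3\sigma_2$, $\tau_2=\sigma_4\sigma_3\sigma_5\sigma_4$, $\tau_3=\sigma_6\sigma_5\sigma_7\sigma_6$ be the flat crossings of the consecutive packets $(x_1,x_2),(x_3,x_4),(x_5,x_6),(x_7,x_8)$. Then: (i) The closed subgroup $\langle\tau_1,\tau_2,\tau_3\rangle\subset\widehat B_8$ is isomorphic to $\widehat B_4$, as a topological group, via $\sigma_i\mapsto\tau_i$, and the action of $F_{\mathcal B}$ on it is the Drinfeld action with $\sigma_i$ replaced by $\tau_i$: $F_{\mathcal B}$ acts on $\tau_1,\tau_2,\tau_3$ by the Drinfeld formulas, and under this isomorphism its restriction to the subgroup corresponds to the continuous automorphism of $\widehat B_4$ acting on $\sigma_1,\sigma_2,\sigma_3$ by the Drinfeld formulas.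 (ii) $F_{\mathcal B}=\mathrm{inn}\bigl(f(\eta_3,\sigma_3^2)\,f(\eta_5,\sigma_5^2)\,f(\eta_7,\sigma_7^2)\bigr)\circ F_{\mathcal B_0}$, where $F_{\mathcal B_0}$ is the standard Drinfeld automorphism. -/

import Mathlib

noncomputable section

namespace GTBraid

/-! ## Profinite completions, profinite powers, profinite words -/

/-- The profinite completion of an abstract group. -/
abbrev Compl (G : Type) [Group G] : ProfiniteGrp.{0} :=
  ProfiniteGrp.ProfiniteCompletion.completion (GrpCat.of G)

/-- The canonical homomorphism from a group to its profinite completion. -/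
def toCompl (G : Type) [Group G] : G →* Compl G :=
  (ProfiniteGrp.ProfiniteCompletion.eta (GrpCat.of G)).hom

/-- The continuous extension to the profinite completion of a homomorphism to a profinite group. -/
def liftCompl {G : Type} [Group G] {P : ProfiniteGrp.{0}} (φ : G →* P) : Compl G →ₜ* P :=
  (ProfiniteGrp.ProfiniteCompletion.lift (P := P) (GrpCat.ofHom φ)).hom

/-- The extension of a homomorphism to the profinite completion does extend it. -/
theorem liftCompl_toCompl {G : Type} [Group G] {P : ProfiniteGrp.{0}} (φ : G →* P) (g : G) :
    liftCompl φ (toCompl G g) = φ g := by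
  have h := ProfiniteGrp.ProfiniteCompletion.lift_eta (P := P) (GrpCat.ofHom φ)
  exact CategoryTheory.ConcreteCategory.congr_hom h g

/-- The profinite integers `Ẑ`, as the profinite completion of `ℤ`. The *additive* group of `Ẑ` is
written multiplicatively here: `a * b` stands for the sum of the profinite integers `a` and `b`. -/
abbrev ZHat : ProfiniteGrp.{0} := Compl (Multiplicative ℤ)

/-- The profinite integer `1`. -/
def oneZ : ZHat := toCompl (Multiplicative ℤ) (Multiplicative.ofAdd 1)

/-- The power `g ^ a` of an element of a profinite group with exponent a profinite integer: the
image of `a` under the continuous homomorphism `Ẑ → P` that sends `1` to `g`. -/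
def ppow {P : ProfiniteGrp.{0}} (g : P) (a : ZHat) : P :=
  liftCompl (zpowersHom P g) a

/-- Multiplication in the ring `Ẑ` (the additive group of `Ẑ` being written multiplicatively,
the product of `a` and `b` is the `b`-th power of `a`). -/
def mulZ (a b : ZHat) : ZHat := ppow a b

/-- Invertibility in the ring `Ẑ`. -/
def IsUnitZ (a : ZHat) : Prop := ∃ b : ZHat, mulZ a b = oneZ ∧ mulZ b a = oneZ

/-- The free profinite group on two generators. -/
abbrev F2Hat : ProfiniteGrp.{0} := Compl (FreeGroup (Fin 2))

/-- The generator `x` of the free profinite group on `x`, `y`. -/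
def genX : F2Hat := toCompl (FreeGroup (Fin 2)) (FreeGroup.of 0)

/-- The generator `y` of the free profinite group on `x`, `y`. -/
def genY : F2Hat := toCompl (FreeGroup (Fin 2)) (FreeGroup.of 1)

/-- The continuous homomorphism from the free profinite group on `x`, `y` to `P` with
`x ↦ a` and `y ↦ b`. -/
def subst {P : ProfiniteGrp.{0}} (a b : P) : F2Hat →ₜ* P :=
  liftCompl (FreeGroup.lift ![a, b])

/-- The element `f(a, b)` obtained by substituting `x ↦ a`, `y ↦ b` in the profinite word `f`. -/
def ev {P : ProfiniteGrp.{0}} (f : F2Hat) (a b : P) : P := subst a b f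

/-! ## Artin braid groups -/

/-- The relators of the Artin braid group on `n` strands; the generator `σ_{i+1}` has
index `i : Fin (n - 1)`. -/
def braidRels (n : ℕ) : Set (FreeGroup (Fin (n - 1))) :=
  {r | ∃ i j : Fin (n - 1), (i : ℕ) + 1 < j ∧
      r = FreeGroup.of i * FreeGroup.of j * (FreeGroup.of j * FreeGroup.of i)⁻¹} ∪
  {r | ∃ i j : Fin (n - 1), (i : ℕ) + 1 = j ∧
      r = FreeGroup.of i * FreeGroup.of j * FreeGroup.of i *
        (FreeGroup.of j * FreeGroup.of i * FreeGroup.of j)⁻¹}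

/-- The Artin braid group on `n` strands. -/
abbrev Braid (n : ℕ) : Type := PresentedGroup (braidRels n)

/-- The profinite Artin braid group on `n` strands. -/
abbrev BHat (n : ℕ) : ProfiniteGrp.{0} := Compl (Braid n)

/-- The standard generator `σ_i`, for `1 ≤ i ≤ n - 1` (and `1` for other values of `i`). -/
def sigma (n i : ℕ) : BHat n :=
  if h : 1 ≤ i ∧ i < n then
    toCompl (Braid n) (PresentedGroup.of (⟨i - 1, by omega⟩ : Fin (n - 1)))
  else 1

/-- `η_i = s_{i-1} ⋯ s_1 · s_1 ⋯ s_{i-1}` for a sequence `s` of group elements; thus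
`η_2 = s_1 ^ 2` and `η_3 = s_2 s_1 ^ 2 s_2`. -/
def eta {P : ProfiniteGrp.{0}} (s : ℕ → P) : ℕ → P
  | 0 => 1
  | 1 => 1
  | i + 2 => s (i + 1) * eta s (i + 1) * s (i + 1)

/-- The full twist `(σ_{o+1} ⋯ σ_{o+k-1}) ^ k` of the packet of the `k` consecutive strands
`o + 1, …, o + k`; a packet is given as the pair `b = (o, k)`. -/
def fullTwist (n : ℕ) (b : ℕ × ℕ) : BHat n :=
  ((List.range (b.2 - 1)).map fun j => sigma n (b.1 + 1 + j)).prod ^ b.2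

/-! ## The Grothendieck-Teichmüller group -/

/-- The elements `(λ, f)` of the profinite Grothendieck-Teichmüller group. -/
structure GT where
  /-- The profinite integer `λ`. -/
  lam : ZHat
  /-- The profinite word `f`. -/
  f : F2Hat
  /-- `λ` is a unit of `Ẑ`. -/
  isUnit_lam : IsUnitZ lam
  /-- `f` lies in the (closed) derived subgroup of the free profinite group. -/
  f_mem : f ∈ (commutator F2Hat).topologicalClosure
  /-- Relation (I): `f(x, y) f(y, x) = 1`. -/
  rel_one : ev f genX genY * ev f genY genX = 1
  /-- Relation (II): `f(x,y) x^m f(z,x) z^m f(y,z) y^m = 1` where `x y z = 1` and `λ = 1 + 2 m`. -/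
  rel_two : ∃ m : ZHat, lam = oneZ * m ^ 2 ∧ ∀ z : F2Hat, genX * genY * z = 1 →
    ev f genX genY * ppow genX m * ev f z genX * ppow z m * ev f genY z * ppow genY m = 1
  /-- Relation (III), the pentagon: with `T_{i…j}` the full twists of packets of four strands,
  `f(T_12, T_234) f(T_123, T_34) = f(T_23, T_34) f(T_123, T_234) f(T_12, T_23)`. -/
  rel_three :
    ev f (fullTwist 4 (0, 2)) (fullTwist 4 (1, 3)) *
        ev f (fullTwist 4 (0, 3)) (fullTwist 4 (2, 2)) =
      ev f (fullTwist 4 (1, 2)) (fullTwist 4 (2, 2)) *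
        ev f (fullTwist 4 (0, 3)) (fullTwist 4 (1, 3)) *
        ev f (fullTwist 4 (0, 2)) (fullTwist 4 (1, 2))
  /-- Invertibility: `x ↦ x^λ`, `y ↦ f⁻¹ y^λ f` is an automorphism of the free profinite group. -/
  bijective : Function.Bijective (subst (ppow genX lam) (f⁻¹ * ppow genY lam * f))

/-- `φ` acts on the sequence `s_1, …, s_{n-1}` by Drinfeld's formulas for `F = (λ, f)`:
`s_1 ↦ s_1^λ`, and `s_i ↦ f(s_i^2, η_i) s_i^λ f(η_i, s_i^2)` for `2 ≤ i ≤ n - 1`. -/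
def IsDrinfeldAction {P : ProfiniteGrp.{0}} (F : GT) (n : ℕ) (s : ℕ → P) (φ : P ≃ₜ* P) : Prop :=
  φ (s 1) = ppow (s 1) F.lam ∧
  ∀ i : ℕ, 2 ≤ i → i ≤ n - 1 →
    φ (s i) = ev F.f (s i ^ 2) (eta s i) * ppow (s i) F.lam * ev F.f (eta s i) (s i ^ 2)

/-! ## Maximal bracketings and A-moves -/

/-- Complete bracketings of a row of points, as planar binary trees. -/
inductive BTree : Type
  | pt : BTree
  | pair : BTree → BTree → BTree

/-- The number of points. -/
def BTree.size : BTree → ℕ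
  | .pt => 1
  | .pair L R => L.size + R.size

/-- Maximal bracketings of `n` points. Every `pair` in the tree other than the outermost one
is a pair of brackets, so that there are `n - 2` of these if `2 ≤ n`. -/
def MaxBracketing (n : ℕ) : Type := {t : BTree // t.size = n}

/-- `AMove o t t' b b'`: if the points of the trees `t` and `t'` are numbered `o + 1, o + 2, …`,
then `t'` arises from `t` by one A-move (in one of the two directions), which replaces the pair of
brackets around the packet `b` by the pair of brackets around the packet `b'`. Here `(j, k)`
denotes the packet of the `k` points `j + 1, …, j + k`. -/
inductive AMove : ℕ → BTree → BTree → ℕ × ℕ → ℕ × ℕ → Prop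
  | assoc (o : ℕ) (X₁ X₂ X₃ : BTree) :
      AMove o (.pair (.pair X₁ X₂) X₃) (.pair X₁ (.pair X₂ X₃))
        (o, X₁.size + X₂.size) (o + X₁.size, X₂.size + X₃.size)
  | symm {o : ℕ} {t t' : BTree} {b b' : ℕ × ℕ} : AMove o t t' b b' → AMove o t' t b' b
  | left {o : ℕ} {L L' : BTree} {b b' : ℕ × ℕ} (R : BTree) :
      AMove o L L' b b' → AMove o (.pair L R) (.pair L' R) b b'
  | right {o : ℕ} {R R' : BTree} {b b' : ℕ × ℕ} (L : BTree) :
      AMove (o + L.size) R R' b b' → AMove o (.pair L R) (.pair L R') b b'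

/-- The tree `((⋯((x_1, x_2), x_3)⋯), x_n`, for `1 ≤ n`. -/
def leftComb : ℕ → BTree
  | 0 => .pt
  | 1 => .pt
  | n + 2 => .pair (leftComb (n + 1)) .pt

theorem size_leftComb : ∀ n : ℕ, 1 ≤ n → (leftComb n).size = n
  | 0, h => absurd h (by decide)
  | 1, _ => rfl
  | n + 2, _ => by
    rw [leftComb, BTree.size, size_leftComb (n + 1) (by omega), BTree.size]

/-- The standard bracketing, with brackets around the points `1, …, i` for `2 ≤ i ≤ n - 1`. -/
def stdBracketing (n : ℕ) [NeZero n] : MaxBracketing n :=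
  ⟨leftComb n, size_leftComb n (Nat.one_le_iff_ne_zero.2 (NeZero.ne n))⟩

/-- `A` is the family `(F_B)` of automorphisms of the profinite braid group on `n` strands, indexed
by maximal bracketings `B`, attached to `F`: at the standard bracketing it is the Drinfeld action
of `F`, and `F_{B'} = inn f(T, T') ∘ F_B` with `inn g = (x ↦ g x g⁻¹)` whenever an A-move from `B`
to `B'` replaces the brackets around a packet with full twist `T` by brackets around a packet with
full twist `T'`. -/
structure IsBracketingFamily (F : GT) {n : ℕ} [NeZero n]
    (A : MaxBracketing n → (BHat n ≃ₜ* BHat n)) : Prop where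
  standard : IsDrinfeldAction F n (sigma n) (A (stdBracketing n))
  amove : ∀ (B B' : MaxBracketing n) (b b' : ℕ × ℕ), AMove 0 B.1 B'.1 b b' →
    ∀ x : BHat n, A B' x =
      ev F.f (fullTwist n b) (fullTwist n b') * A B x *
        (ev F.f (fullTwist n b) (fullTwist n b'))⁻¹

/-! ## Doubled strands in the profinite braid group on eight strands -/

/-- The packet `(x_{2i-1}, x_{2i})` of two points. -/
def twoPts : BTree := .pair .pt .pt

/-- The bracketing `(((x₁,x₂),(x₃,x₄)),(x₅,x₆)),(x₇,x₈)`. -/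
def doubleBracketing : MaxBracketing 8 :=
  ⟨.pair (.pair (.pair twoPts twoPts) twoPts) twoPts, rfl⟩

/-- The flat crossing `τ_i = σ_{2i} σ_{2i-1} σ_{2i+1} σ_{2i}` of the packet `(x_{2i-1}, x_{2i})`
with the packet `(x_{2i+1}, x_{2i+2})`, for `i = 1, 2, 3`. -/
def tau (i : ℕ) : BHat 8 :=
  sigma 8 (2 * i) * sigma 8 (2 * i - 1) * sigma 8 (2 * i + 1) * sigma 8 (2 * i)

/-- The closed subgroup topologically generated by `τ_1, τ_2, τ_3`. -/
def tauSubgroup : Subgroup (BHat 8) :=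
  (Subgroup.closure {tau 1, tau 2, tau 3}).topologicalClosure

end GTBraid

end

noncomputable section

namespace GTBraid

/-! ## Homomorphisms out of profinite completions -/

/-! The relations of `GT` involve single strands; the theorem needs them with every strand replaced
by a packet of parallel strands. Cabling is a homomorphism only on braids that preserve the packet
sizes, and it has to be applied to profinite words. Both difficulties disappear in a finite quotient
`Q`: the braid group acts on the finite set (arrangements of packet sizes) × `Q`, where a generator
exchanges two packets and multiplies by their crossing. A word in braids fixing an arrangement then
acts by the same word in their cablings (`IsCabling.ev`). A cabled twist differs from the full twist
of the union only by internal twists, which commute with everything involved and drop out of `f`,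
because `f` lies in the closed derived subgroup (`GT.ev_mul_central`). This gives `GT.pentagon` and
`GT.hexagon_packets` for packets of all sizes, including empty ones.

The Drinfeld formulas respect the braid relations: the pentagon for packets `k, 1, 1, 1` conjugates
the values at two neighbouring generators simultaneously to the case of three strands, which is the
hexagon (`GT.drinfeld_braid`). The resulting endomorphism is surjective because the substitution
attached to `F` is bijective, and hence injective because the group is Hopfian
(`GT.exists_drinfeld`).

The family is given by the Drinfeld automorphism followed by conjugation with the inverse of an
explicit product of associators, `GT.normalizer`. The pentagon shows that an A-move changes this
product by exactly its own associator (`GT.normalizer_eq`), which gives existence; uniqueness holds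
because A-moves connect all bracketings.

For the flat crossings, brackets around two adjacent points make the crossing of these points go to
its `λ`-th power (`GT.family_sigma`). Two A-moves inside `(x₁,x₂),(x₃,x₄)` then express the image of
a flat crossing, and one pentagon with three hexagons evaluates it as a `λ`-th power
(`GT.flat_crossing`). One further A-move brings the second or third pair of neighbouring packets
together, and its associator is the one in the Drinfeld formula for the `τ_i`. Doubling of strands
is injective because keeping one strand of each pair, a cabling with packets of sizes `1` and `0`,
undoes it (`isCabling_doubling`). Part (ii) composes three A-moves with commuting associators. -/

theorem denseRange_toCompl (G : Type) [Group G] : DenseRange (toCompl G) :=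
  ProfiniteGrp.ProfiniteCompletion.denseRange (GrpCat.of G)

theorem compl_funext {G : Type} [Group G] {X : Type*} [TopologicalSpace X] [T2Space X]
    {f g : Compl G → X} (hf : Continuous f) (hg : Continuous g)
    (h : ∀ x : G, f (toCompl G x) = g (toCompl G x)) : f = g :=
  (denseRange_toCompl G).equalizer hf hg (funext h)

theorem compl_hom_ext {G : Type} [Group G] {M : Type*} [Monoid M] [TopologicalSpace M] [T2Space M]
    {f g : Compl G →ₜ* M} (h : ∀ x : G, f (toCompl G x) = g (toCompl G x)) : f = g :=
  DFunLike.coe_injective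
    (compl_funext (map_continuous f) (map_continuous g) h)

variable {P Q : ProfiniteGrp.{0}}

/-- Points of a profinite group are separated by homomorphisms to finite groups. -/
theorem eq_of_forall_finite {x y : P}
    (h : ∀ (Q : ProfiniteGrp.{0}) [Finite Q] (φ : P →ₜ* Q), φ x = φ y) : x = y := by
  apply P.toLimit_injective
  apply Subtype.ext
  funext U
  have : Finite ((ProfiniteGrp.diagram P).obj U) :=
    inferInstanceAs (Finite (P ⧸ U.toSubgroup))
  exact h ((ProfiniteGrp.diagram P).obj U) (ProfiniteGrp.proj U).hom

/-! ## Substitution into profinite words -/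

theorem liftCompl_comp {G : Type} [Group G] (φ : P →ₜ* Q) (ψ : G →* P) (x : Compl G) :
    φ (liftCompl ψ x) = liftCompl ((φ : P →* Q).comp ψ) x := by
  have : φ.comp (liftCompl ψ) = liftCompl ((φ : P →* Q).comp ψ) := by
    apply compl_hom_ext
    intro x
    rw [liftCompl_toCompl]
    change φ (liftCompl ψ (toCompl G x)) = _
    rw [liftCompl_toCompl]
    rfl
  exact DFunLike.congr_fun this x

theorem map_ev (φ : P →ₜ* Q) (f : F2Hat) (a b : P) : φ (ev f a b) = ev f (φ a) (φ b) := by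
  unfold ev subst
  rw [liftCompl_comp]
  congr 2
  ext i
  fin_cases i <;> simp

theorem map_ppow (φ : P →ₜ* Q) (g : P) (m : ZHat) : φ (ppow g m) = ppow (φ g) m := by
  unfold ppow
  rw [liftCompl_comp]
  congr 2
  ext
  simp

theorem ev_genX (a b : P) : ev genX a b = a := by
  simp [ev, subst, genX, liftCompl_toCompl]

theorem ev_genY (a b : P) : ev genY a b = b := by
  simp [ev, subst, genY, liftCompl_toCompl]

theorem ev_mul (f g : F2Hat) (a b : P) : ev (f * g) a b = ev f a b * ev g a b :=
  map_mul _ _ _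

theorem ev_inv (f : F2Hat) (a b : P) : ev f⁻¹ a b = (ev f a b)⁻¹ :=
  map_inv _ _

theorem ev_ev (f u v : F2Hat) (a b : P) : ev (ev f u v) a b = ev f (ev u a b) (ev v a b) :=
  map_ev (subst a b) f u v

theorem liftCompl_mem {G : Type} [Group G] {ψ : G →* P} {H : Subgroup P}
    (hH : IsClosed (H : Set P)) (h : ∀ x, ψ x ∈ H) (x : Compl G) : liftCompl ψ x ∈ H := by
  have hc : IsClosed (liftCompl ψ ⁻¹' (H : Set P)) := hH.preimage (map_continuous _)
  have := (denseRange_toCompl G).closure_eq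
  have hsub : closure (Set.range (toCompl G)) ⊆ liftCompl ψ ⁻¹' (H : Set P) := by
    apply closure_minimal _ hc
    rintro _ ⟨y, rfl⟩
    simpa [liftCompl_toCompl] using h y
  exact hsub (this ▸ Set.mem_univ x)

theorem ev_mem {H : Subgroup P} (hH : IsClosed (H : Set P)) (f : F2Hat) {a b : P}
    (ha : a ∈ H) (hb : b ∈ H) : ev f a b ∈ H := by
  apply liftCompl_mem hH
  intro w
  have : (FreeGroup.lift ![a, b]).range ≤ H := by
    refine FreeGroup.range_lift_le (Set.range_subset_iff.2 fun i => ?_)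
    fin_cases i <;> simpa
  exact this ⟨w, rfl⟩

theorem ppow_mem {H : Subgroup P} (hH : IsClosed (H : Set P)) (m : ZHat) {a : P}
    (ha : a ∈ H) : ppow a m ∈ H := by
  apply liftCompl_mem hH
  intro w
  exact H.zpow_mem ha _

/-! ## Profinite powers -/

theorem ppow_toCompl (g : P) (k : ℤ) :
    ppow g (toCompl (Multiplicative ℤ) (Multiplicative.ofAdd k)) = g ^ k := by
  simp [ppow, liftCompl_toCompl]

theorem ppow_oneZ (g : P) : ppow g oneZ = g := by
  rw [oneZ, ppow_toCompl, zpow_one]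

theorem ppow_mul (g : P) (a b : ZHat) : ppow g (a * b) = ppow g a * ppow g b := map_mul _ _ _

theorem ppow_pow (g : P) (a : ZHat) (k : ℕ) : ppow g (a ^ k) = ppow g a ^ k := map_pow _ _ _

theorem continuous_ppow (g : P) : Continuous (ppow g) := map_continuous (liftCompl _)

theorem ppow_mulZ (g : P) (a b : ZHat) : ppow g (mulZ a b) = ppow (ppow g a) b :=
  map_ppow (liftCompl (zpowersHom P g)) a b

theorem ppow_mul_of_commute {g h : P} (hc : Commute g h) (m : ZHat) :
    ppow (g * h) m = ppow g m * ppow h m := by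
  have := compl_funext (G := Multiplicative ℤ) (continuous_ppow (g * h))
    ((continuous_ppow g).mul (continuous_ppow h)) (fun x => by
      change ppow (g * h) (toCompl _ (Multiplicative.ofAdd (Multiplicative.toAdd x))) =
        ppow g (toCompl _ (Multiplicative.ofAdd (Multiplicative.toAdd x))) *
        ppow h (toCompl _ (Multiplicative.ofAdd (Multiplicative.toAdd x)))
      rw [ppow_toCompl, ppow_toCompl, ppow_toCompl, hc.mul_zpow])
  exact congrFun this m

theorem ppow_inv (g : P) (m : ZHat) : ppow g⁻¹ m = (ppow g m)⁻¹ := by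
  have := compl_funext (G := Multiplicative ℤ) (continuous_ppow g⁻¹)
    (continuous_ppow g).inv (fun x => by
      change ppow g⁻¹ (toCompl _ (Multiplicative.ofAdd (Multiplicative.toAdd x))) =
        (ppow g (toCompl _ (Multiplicative.ofAdd (Multiplicative.toAdd x))))⁻¹
      rw [ppow_toCompl, ppow_toCompl, inv_zpow])
  exact congrFun this m

/-! ## Conjugation -/

/-- The inner automorphism `x ↦ g x g⁻¹`. -/
def inn (g : P) : P ≃ₜ* P :=
  { MulAut.conj g with
    continuous_toFun := by
      change Continuous fun x => g * x * g⁻¹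
      fun_prop
    continuous_invFun := by
      change Continuous fun x => g⁻¹ * x * g
      fun_prop }

theorem inn_apply (g x : P) : inn g x = g * x * g⁻¹ := rfl

/-- A continuous group isomorphism as a continuous homomorphism. -/
def toHom (e : P ≃ₜ* Q) : P →ₜ* Q := ⟨e.toMulEquiv.toMonoidHom, e.continuous_toFun⟩

theorem toHom_apply (e : P ≃ₜ* Q) (x : P) : toHom e x = e x := rfl

theorem equiv_ev (e : P ≃ₜ* Q) (f : F2Hat) (a b : P) : e (ev f a b) = ev f (e a) (e b) :=
  map_ev (toHom e) f a b

theorem equiv_ppow (e : P ≃ₜ* Q) (g : P) (m : ZHat) : e (ppow g m) = ppow (e g) m :=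
  map_ppow (toHom e) g m

theorem semiconjBy_iff_inn {g x y : P} : SemiconjBy g x y ↔ inn g x = y := by
  rw [inn_apply, mul_inv_eq_iff_eq_mul]; rfl

theorem semiconjBy_ev (f : F2Hat) {g a a' b b' : P} (ha : SemiconjBy g a a')
    (hb : SemiconjBy g b b') : SemiconjBy g (ev f a b) (ev f a' b') := by
  rw [semiconjBy_iff_inn] at *
  rw [equiv_ev, ha, hb]

theorem semiconjBy_ppow (m : ZHat) {g a a' : P} (ha : SemiconjBy g a a') :
    SemiconjBy g (ppow a m) (ppow a' m) := by
  rw [semiconjBy_iff_inn] at *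
  rw [equiv_ppow, ha]

theorem commute_ev (f : F2Hat) {g a b : P} (ha : Commute g a) (hb : Commute g b) :
    Commute g (ev f a b) := semiconjBy_ev f ha hb

theorem commute_ppow (m : ZHat) {g a : P} (ha : Commute g a) : Commute g (ppow a m) :=
  semiconjBy_ppow m ha

theorem conj_ev (f : F2Hat) (g a b : P) :
    ev f (g * a * g⁻¹) (g * b * g⁻¹) = g * ev f a b * g⁻¹ := (equiv_ev (inn g) f a b).symm

theorem conj_ppow (g a : P) (m : ZHat) :
    ppow (g * a * g⁻¹) m = g * ppow a m * g⁻¹ := (equiv_ppow (inn g) a m).symm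

/-! ## Words in the derived subgroup -/

/-- Centralizers are closed, so commutation extends from the dense images to the completions, in one
variable at a time. -/
theorem commute_liftCompl {G H : Type} [Group G] [Group H] {φ : G →* P} {ψ : H →* P}
    (h : ∀ x y, Commute (φ x) (ψ y)) (x : Compl G) (y : Compl H) :
    Commute (liftCompl φ x) (liftCompl ψ y) := by
  have hc : ∀ g : P, IsClosed ((Subgroup.centralizer {g} : Subgroup P) : Set P) := fun g =>
    Set.isClosed_centralizer _
  have h1 : ∀ x y, Commute (φ x) (liftCompl ψ y) := fun x y => by
    have := liftCompl_mem (hc (φ x)) (ψ := ψ) (fun y => by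
      rw [Subgroup.mem_centralizer_singleton_iff]; exact (h x y).symm.eq) y
    rw [Subgroup.mem_centralizer_singleton_iff] at this
    exact this.symm
  have := liftCompl_mem (hc (liftCompl ψ y)) (ψ := φ) (fun x => by
      rw [Subgroup.mem_centralizer_singleton_iff]; exact (h1 x y).eq) x
  rw [Subgroup.mem_centralizer_singleton_iff] at this
  exact this

theorem commute_lift {G : Type*} [Group G] {a b c d : G} (hac : Commute a c) (had : Commute a d)
    (hbc : Commute b c) (hbd : Commute b d) (x y : FreeGroup (Fin 2)) :
    Commute (FreeGroup.lift ![a, b] x) (FreeGroup.lift ![c, d] y) := by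
  have h1 : ∀ g, Commute a g → Commute b g → ∀ x, Commute (FreeGroup.lift ![a, b] x) g := by
    intro g ha hb x
    have : (FreeGroup.lift ![a, b]).range ≤ Subgroup.centralizer {g} := by
      refine FreeGroup.range_lift_le (Set.range_subset_iff.2 fun i => ?_)
      fin_cases i <;> simp [Subgroup.mem_centralizer_singleton_iff, ha.eq, hb.eq]
    have := this ⟨x, rfl⟩
    rw [Subgroup.mem_centralizer_singleton_iff] at this
    exact this
  have h2 : ∀ g, Commute g c → Commute g d → ∀ x, Commute g (FreeGroup.lift ![c, d] x) := by
    intro g ha hb x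
    have : (FreeGroup.lift ![c, d]).range ≤ Subgroup.centralizer {g} := by
      refine FreeGroup.range_lift_le (Set.range_subset_iff.2 fun i => ?_)
      fin_cases i <;> simp [Subgroup.mem_centralizer_singleton_iff, ha.eq, hb.eq]
    have := this ⟨x, rfl⟩
    rw [Subgroup.mem_centralizer_singleton_iff] at this
    exact this.symm
  exact h2 _ (h1 _ hac hbc x) (h1 _ had hbd x) y

theorem commute_ev_ev (f g : F2Hat) {a b c d : P} (hac : Commute a c) (had : Commute a d)
    (hbc : Commute b c) (hbd : Commute b d) : Commute (ev f a b) (ev g c d) :=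
  commute_liftCompl (commute_lift hac had hbc hbd) f g

/-- Since the two evaluations have commuting images, their pointwise product is again a
homomorphism; it agrees with the left side on generators, hence on discrete words, hence by density
on all profinite ones. -/
theorem ev_mul_mul (f : F2Hat) {a b c d : P} (hac : Commute a c) (had : Commute a d)
    (hbc : Commute b c) (hbd : Commute b d) :
    ev f (a * c) (b * d) = ev f a b * ev f c d := by
  have hw : ∀ w, FreeGroup.lift ![a * c, b * d] w =
      FreeGroup.lift ![a, b] w * FreeGroup.lift ![c, d] w := by
    intro w
    let ψ : FreeGroup (Fin 2) →* P := MonoidHom.mk'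
      (fun w => FreeGroup.lift ![a, b] w * FreeGroup.lift ![c, d] w) (fun x y => by
        rw [map_mul, map_mul, (commute_lift hac had hbc hbd y x).mul_mul_mul_comm])
    have : FreeGroup.lift ![a * c, b * d] = ψ := by
      ext i
      fin_cases i <;> simp [ψ]
    exact DFunLike.congr_fun this w
  have := compl_funext (G := FreeGroup (Fin 2)) (map_continuous (subst (a * c) (b * d)))
    ((map_continuous (subst a b)).mul (map_continuous (subst c d))) (fun w => by
      simp only [subst, Pi.mul_apply, liftCompl_toCompl]
      exact hw w)
  exact congrFun this f

/-- The substitution has commutative image, so its kernel is a closed subgroup containing all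
commutators. -/
theorem ev_eq_one_of_commute {f : F2Hat} (hf : f ∈ (commutator F2Hat).topologicalClosure)
    {a b : P} (hab : Commute a b) : ev f a b = 1 := by
  have hle : commutator F2Hat ≤ (subst a b : F2Hat →* P).ker := by
    rw [commutator_def, Subgroup.commutator_le]
    intro u _ v _
    have : Commute (ev u a b) (ev v a b) :=
      commute_ev_ev u v (Commute.refl a) hab hab.symm (Commute.refl b)
    rw [MonoidHom.mem_ker, map_commutatorElement, commutatorElement_eq_one_iff_commute]
    exact this
  have hcl : IsClosed ((subst a b : F2Hat →* P).ker : Set F2Hat) := by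
    have : IsClosed ((subst a b) ⁻¹' {1}) := isClosed_singleton.preimage (map_continuous _)
    exact this
  exact Subgroup.topologicalClosure_minimal _ hle hcl hf

namespace GT

variable (F : GT)

theorem ev_one {a b : P} (hab : Commute a b) : ev F.f a b = 1 :=
  ev_eq_one_of_commute F.f_mem hab

/-- Used throughout to ignore central factors in the arguments of an associator, in particular
internal twists of packets. -/
theorem ev_mul_central {a b c d : P} (hac : Commute a c) (had : Commute a d)
    (hbc : Commute b c) (hbd : Commute b d) (hcd : Commute c d) :
    ev F.f (a * c) (b * d) = ev F.f a b := by
  rw [ev_mul_mul _ hac had hbc hbd, F.ev_one hcd, mul_one]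

theorem ev_symm_mul (a b : P) : ev F.f a b * ev F.f b a = 1 := by
  have := congrArg (fun w => ev w a b) F.rel_one
  simpa only [ev_mul, ev_ev, ev_genX, ev_genY, show ev (1 : F2Hat) a b = 1 from map_one _] using this

theorem inv_ev (a b : P) : (ev F.f a b)⁻¹ = ev F.f b a :=
  inv_eq_of_mul_eq_one_right (F.ev_symm_mul a b)

/-- A profinite integer `m` with `λ = 1 + 2 m` for which relation (II) holds. -/
@[irreducible] def half : ZHat := F.rel_two.choose

theorem half_spec : F.lam = oneZ * F.half ^ 2 ∧ ∀ z : F2Hat, genX * genY * z = 1 →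
    ev F.f genX genY * ppow genX F.half * ev F.f z genX * ppow z F.half *
      ev F.f genY z * ppow genY F.half = 1 := by
  unfold half
  exact F.rel_two.choose_spec

theorem lam_eq : F.lam = oneZ * F.half ^ 2 := F.half_spec.1

theorem ppow_lam (g : P) : ppow g F.lam = g * ppow (g ^ 2) F.half := by
  rw [lam_eq, ppow_mul, ppow_oneZ, ppow_pow, sq, sq, ppow_mul_of_commute (Commute.refl g)]

theorem ppow_lam' (g : P) : ppow g F.lam = ppow (g ^ 2) F.half * g := by
  rw [ppow_lam]
  exact commute_ppow _ ((Commute.refl g).pow_right 2)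

theorem hexagon (x y z : P) (h : x * y * z = 1) :
    ev F.f x y * ppow x F.half * ev F.f z x * ppow z F.half * ev F.f y z * ppow y F.half = 1 := by
  have := congrArg (fun w => ev w x y) (F.half_spec.2 (genX * genY)⁻¹ (by simp))
  have hz : z = (x * y)⁻¹ := (inv_eq_of_mul_eq_one_right h).symm
  have hp : ∀ (u : F2Hat) (m : ZHat), ev (ppow u m) x y = ppow (ev u x y) m :=
    fun u m => map_ppow (subst x y) u m
  simpa only [ev_mul, ev_ev, ev_inv, ev_genX, ev_genY, hp, ← hz,
    show ev (1 : F2Hat) x y = 1 from map_one _] using this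

theorem exists_ppow_ppow_lam : ∃ μ : ZHat, ∀ (P : ProfiniteGrp.{0}) (g : P),
    ppow (ppow g F.lam) μ = g := by
  obtain ⟨μ, h, -⟩ := F.isUnit_lam
  exact ⟨μ, fun P g => by rw [← ppow_mulZ, h, ppow_oneZ]⟩

theorem mem_of_ppow_lam_mem {H : Subgroup P} (hH : IsClosed (H : Set P)) {g : P}
    (h : ppow g F.lam ∈ H) : g ∈ H := by
  obtain ⟨μ, hμ⟩ := F.exists_ppow_ppow_lam
  rw [← hμ P g]
  exact ppow_mem hH μ h

end GT

/-! ## Crossings and twists of packets in a group with braid relations -/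

/-- The elements `s_1, …, s_{N-1}` satisfy the braid relations of the braid group on `N` strands,
and distant terms of the whole sequence commute. -/
structure IsBraidSeq {G : Type*} [Group G] (N : ℕ) (s : ℕ → G) : Prop where
  comm : ∀ i j, i + 2 ≤ j → Commute (s i) (s j)
  braid : ∀ i, 1 ≤ i → i + 1 < N → s i * s (i + 1) * s i = s (i + 1) * s i * s (i + 1)

section Packets

variable {G : Type*} [Group G]

/-- The product `s_{o+b} ⋯ s_{o+1}`, in which the strand at `o + 1` crosses the next `b` strands. -/
def strandCrossing (s : ℕ → G) (o : ℕ) : ℕ → G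
  | 0 => 1
  | b + 1 => s (o + b + 1) * strandCrossing s o b

/-- The flat crossing of the packet `o + 1, …, o + a` with the packet of the next `b` strands. -/
def crossing (s : ℕ → G) (o : ℕ) : ℕ → ℕ → G
  | 0, _ => 1
  | a + 1, b => crossing s o a b * strandCrossing s (o + a) b

/-- The product `s_{o+1} ⋯ s_{o+k}`. -/
def ascending (s : ℕ → G) (o k : ℕ) : G := ((List.range k).map fun j => s (o + 1 + j)).prod

/-- The full twist of the packet `o + 1, …, o + k`. -/
def twist (s : ℕ → G) (o k : ℕ) : G := ascending s o (k - 1) ^ k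

theorem map_ascending {H : Type*} [Group H] (φ : G →* H) (s : ℕ → G) (o k : ℕ) :
    φ (ascending s o k) = ascending (fun i => φ (s i)) o k := by
  simp [ascending, map_list_prod, Function.comp_def]

theorem map_twist {H : Type*} [Group H] (φ : G →* H) (s : ℕ → G) (o k : ℕ) :
    φ (twist s o k) = twist (fun i => φ (s i)) o k := by
  simp [twist, map_ascending]

theorem ascending_succ (s : ℕ → G) (o k : ℕ) :
    ascending s o (k + 1) = ascending s o k * s (o + k + 1) := by
  simp [ascending, List.range_succ, show o + 1 + k = o + k + 1 by omega]

theorem twist_zero (s : ℕ → G) (o : ℕ) : twist s o 0 = 1 := pow_zero _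

theorem twist_one (s : ℕ → G) (o : ℕ) : twist s o 1 = 1 := by simp [twist, ascending]

theorem twist_two (s : ℕ → G) (o : ℕ) : twist s o 2 = s (o + 1) ^ 2 := by simp [twist, ascending]

variable {s : ℕ → G}

/-- Conjugation that shifts the generators by `d` shifts everything built from them. The case `d =
0` is commutation; the case of a crossing as `g` describes how braids inside a packet slide through
it. -/
theorem semiconjBy_strandCrossing {g : G} {o b d : ℕ}
    (h : ∀ i, o < i → i ≤ o + b → SemiconjBy g (s i) (s (i + d))) :
    SemiconjBy g (strandCrossing s o b) (strandCrossing s (o + d) b) := by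
  induction b with
  | zero => exact SemiconjBy.one_right g
  | succ b ih =>
    have := h (o + b + 1) (by omega) (by omega)
    rw [show o + b + 1 + d = o + d + b + 1 by omega] at this
    exact this.mul_right (ih fun i h1 h2 => h i h1 (by omega))

theorem semiconjBy_crossing {g : G} {o a b d : ℕ}
    (h : ∀ i, o < i → i < o + a + b → SemiconjBy g (s i) (s (i + d))) :
    SemiconjBy g (crossing s o a b) (crossing s (o + d) a b) := by
  induction a with
  | zero => exact SemiconjBy.one_right g
  | succ a ih =>
    have := semiconjBy_strandCrossing (s := s) (g := g) (o := o + a) (b := b) (d := d)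
      fun i h1 h2 => h i (by omega) (by omega)
    rw [show o + a + d = o + d + a by omega] at this
    exact (ih fun i h1 h2 => h i h1 (by omega)).mul_right this

theorem semiconjBy_ascending {g : G} {o k d : ℕ}
    (h : ∀ i, o < i → i ≤ o + k → SemiconjBy g (s i) (s (i + d))) :
    SemiconjBy g (ascending s o k) (ascending s (o + d) k) := by
  induction k with
  | zero => exact SemiconjBy.one_right g
  | succ k ih =>
    have := h (o + k + 1) (by omega) (by omega)
    rw [show o + k + 1 + d = o + d + k + 1 by omega] at this
    rw [ascending_succ, ascending_succ]
    exact (ih fun i h1 h2 => h i h1 (by omega)).mul_right this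

theorem semiconjBy_twist {g : G} {o k d : ℕ}
    (h : ∀ i, o < i → i < o + k → SemiconjBy g (s i) (s (i + d))) :
    SemiconjBy g (twist s o k) (twist s (o + d) k) :=
  (semiconjBy_ascending fun i h1 h2 => h i h1 (by omega)).pow_right k

theorem commute_strandCrossing {g : G} {o b : ℕ}
    (h : ∀ i, o < i → i ≤ o + b → Commute g (s i)) : Commute g (strandCrossing s o b) :=
  semiconjBy_strandCrossing (d := 0) h

theorem commute_crossing {g : G} {o a b : ℕ}
    (h : ∀ i, o < i → i < o + a + b → Commute g (s i)) : Commute g (crossing s o a b) :=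
  semiconjBy_crossing (d := 0) h

theorem commute_twist {g : G} {o k : ℕ}
    (h : ∀ i, o < i → i < o + k → Commute g (s i)) : Commute g (twist s o k) :=
  semiconjBy_twist (d := 0) h

theorem strandCrossing_add (o b b' : ℕ) :
    strandCrossing s o (b + b') = strandCrossing s (o + b) b' * strandCrossing s o b := by
  induction b' with
  | zero => simp [strandCrossing]
  | succ b' ih =>
    rw [← Nat.add_assoc, strandCrossing, ih, strandCrossing, mul_assoc, Nat.add_assoc o b b']

theorem strandCrossing_one (o : ℕ) : strandCrossing s o 1 = s (o + 1) := by simp [strandCrossing]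

theorem crossing_add_left (o a a' b : ℕ) :
    crossing s o (a + a') b = crossing s o a b * crossing s (o + a) a' b := by
  induction a' with
  | zero => simp [crossing]
  | succ a' ih => rw [← Nat.add_assoc, crossing, ih, crossing, mul_assoc, Nat.add_assoc o a a']

theorem crossing_zero_right (o a : ℕ) : crossing s o a 0 = 1 := by
  induction a with
  | zero => rfl
  | succ a ih => rw [crossing, ih, strandCrossing, one_mul]

theorem crossing_one_left (o b : ℕ) : crossing s o 1 b = strandCrossing s o b := by
  simp [crossing]

theorem crossing_one_right (o a : ℕ) : crossing s o a 1 = ascending s o a := by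
  induction a with
  | zero => rfl
  | succ a ih => rw [crossing, ih, strandCrossing_one, ascending_succ]

namespace IsBraidSeq

variable {N : ℕ}

/-- Each strand of the first packet crosses `b` and then `b'` strands. The crossings of earlier
strands with `b` and of the last strand with `b'` use generators at distance at least two, so they
may be interchanged. -/
theorem crossing_add_right (hs : IsBraidSeq N s) (o a b b' : ℕ) :
    crossing s o a (b + b') = crossing s (o + b) a b' * crossing s o a b := by
  induction a with
  | zero => simp [crossing]
  | succ a ih =>
    have hc : Commute (crossing s o a b) (strandCrossing s (o + b + a) b') :=
      commute_strandCrossing fun i h1 h2 =>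
        (commute_crossing fun j h3 h4 => (hs.comm j i (by omega)).symm).symm
    rw [crossing, ih, strandCrossing_add, crossing, crossing]
    rw [show o + a + b = o + b + a by omega]
    simp only [mul_assoc]
    rw [← mul_assoc (crossing s o a b), hc.eq, mul_assoc]

/-- A crossing among the `b` strands slides past the single strand that crosses all of them; the one
braid relation needed occurs at the generators `j` and `j + 1`. -/
theorem strandCrossing_semiconj (hs : IsBraidSeq N s) {o b j : ℕ} (hj : o < j) (hjb : j < o + b)
    (hN : o + b < N) : SemiconjBy (strandCrossing s o b) (s (j + 1)) (s j) := by
  induction b with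
  | zero => omega
  | succ b ih =>
    rw [strandCrossing]
    rcases Nat.lt_or_ge j (o + b) with h | h
    · have h1 : SemiconjBy (s (o + b + 1)) (s j) (s j) := (hs.comm j (o + b + 1) (by omega)).symm
      exact h1.mul_left (ih h (by omega))
    · obtain ⟨b, rfl⟩ : ∃ c, b = c + 1 := ⟨b - 1, by omega⟩
      obtain rfl : j = o + b + 1 := by omega
      have hc : Commute (s (o + b + 1 + 1)) (strandCrossing s o b) :=
        commute_strandCrossing fun i h1 h2 => (hs.comm i _ (by omega)).symm
      have hb := hs.braid (o + b + 1) (by omega) (by omega)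
      rw [strandCrossing, ← Nat.add_assoc]
      change _ * _ = _ * _
      rw [mul_assoc, mul_assoc, ← hc.eq, ← mul_assoc, ← mul_assoc, ← hb]
      simp only [mul_assoc]

/-- The crossing of two parallel strands travels with them across `b` further strands, by one braid
relation per strand crossed. -/
theorem strandCrossing_mul_semiconj (hs : IsBraidSeq N s) {o b : ℕ} (hN : o + b + 1 < N) :
    SemiconjBy (strandCrossing s o b * strandCrossing s (o + 1) b) (s (o + 1)) (s (o + b + 1)) := by
  induction b with
  | zero => exact SemiconjBy.mul_left (SemiconjBy.one_left _) (SemiconjBy.one_left _)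
  | succ b ih =>
    have hc : Commute (s (o + 1 + b + 1)) (strandCrossing s o b) :=
      commute_strandCrossing fun i h1 h2 => (hs.comm i _ (by omega)).symm
    have hb := hs.braid (o + b + 1) (by omega) (by omega)
    have h2 : SemiconjBy (s (o + b + 1) * s (o + 1 + b + 1)) (s (o + b + 1))
        (s (o + (b + 1) + 1)) := by
      rw [show o + 1 + b + 1 = o + b + 1 + 1 by omega, show o + (b + 1) + 1 = o + b + 1 + 1 by omega]
      change _ * _ = _ * _
      rw [hb]; simp only [mul_assoc]
    have h3 := h2.mul_left (ih (by omega))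
    have h4 : strandCrossing s o (b + 1) * strandCrossing s (o + 1) (b + 1) =
        s (o + b + 1) * s (o + 1 + b + 1) * (strandCrossing s o b * strandCrossing s (o + 1) b) := by
      rw [strandCrossing, strandCrossing, mul_assoc, mul_assoc, ← mul_assoc (strandCrossing s o b),
        ← hc.eq, mul_assoc]
    rwa [h4]

theorem crossing_semiconj_left (hs : IsBraidSeq N s) {o a b j : ℕ} (hj : o < j) (hja : j < o + a)
    (hN : o + a + b ≤ N) : SemiconjBy (crossing s o a b) (s j) (s (j + b)) := by
  induction a with
  | zero => omega
  | succ a ih =>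
    rcases Nat.lt_or_ge j (o + a) with h | h
    · have hc : Commute (strandCrossing s (o + a) b) (s j) :=
        (commute_strandCrossing fun i h1 h2 => hs.comm j i (by omega)).symm
      exact (ih h (by omega)).mul_left hc
    · obtain ⟨a, rfl⟩ : ∃ c, a = c + 1 := ⟨a - 1, by omega⟩
      obtain rfl : j = o + a + 1 := by omega
      have h1 := hs.strandCrossing_mul_semiconj (o := o + a) (b := b) (by omega)
      have hc : Commute (crossing s o a b) (s (o + a + b + 1)) :=
        (commute_crossing fun i h1 h2 => (hs.comm i _ (by omega)).symm).symm
      have h3 := SemiconjBy.mul_left hc h1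
      rw [crossing, crossing, mul_assoc]
      rw [show o + a + 1 + b = o + a + b + 1 by omega]
      exact h3

theorem crossing_semiconj_right (hs : IsBraidSeq N s) {o a b j : ℕ} (hj : o < j) (hjb : j < o + b)
    (hN : o + a + b ≤ N) : SemiconjBy (crossing s o a b) (s (j + a)) (s j) := by
  induction a with
  | zero => exact SemiconjBy.one_left _
  | succ a ih =>
    have h1 := hs.strandCrossing_semiconj (o := o + a) (b := b) (j := j + a) (by omega) (by omega)
      (by omega)
    exact (ih (by omega)).mul_left h1

/-- The braid relation for three packets. -/
theorem crossing_braid (hs : IsBraidSeq N s) {o a b c : ℕ} (hN : o + a + b + c ≤ N) :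
    crossing s o b c * crossing s (o + b) a c * crossing s o a b =
      crossing s (o + c) a b * crossing s o a c * crossing s (o + a) b c := by
  -- The crossing of `a` with `b` happens inside the packet `a + b`, so it slides through the
  -- crossing of that packet with `c`.
  have h := semiconjBy_crossing (s := s) (g := crossing s o (a + b) c) (o := o) (a := a) (b := b)
    (d := c) fun i h1 h2 => hs.crossing_semiconj_left h1 (by omega) (by omega)
  rw [← crossing_add_left, mul_assoc, ← crossing_add_left, Nat.add_comm b a]
  exact h

theorem crossing_far (hs : IsBraidSeq N s) {o a b o' a' b' : ℕ} (h : o + a + b ≤ o') :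
    Commute (crossing s o a b) (crossing s o' a' b') :=
  commute_crossing fun i h1 h2 =>
    (commute_crossing fun j h3 h4 => (hs.comm j i (by omega)).symm).symm

/-! ### Full twists -/

theorem ascending_semiconj (hs : IsBraidSeq N s) {o k j : ℕ} (hj : o < j) (hjk : j < o + k)
    (hN : o + k < N) : SemiconjBy (ascending s o k) (s j) (s (j + 1)) := by
  rw [← crossing_one_right]
  exact hs.crossing_semiconj_left hj hjk (by omega)

/-- `ascending ^ j` unravels to a shorter power followed by a descending product. -/
theorem ascending_succ_pow (hs : IsBraidSeq N s) {o k j : ℕ} (hj : j ≤ k + 1) (hN : o + k + 1 < N) :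
    ascending s o (k + 1) ^ j =
      ascending s o k ^ j * strandCrossing s (o + (k + 1 - j)) j := by
  induction j with
  | zero => simp [strandCrossing]
  | succ j ih =>
    have h1 : SemiconjBy (ascending s o (k + 1)) (strandCrossing s (o + (k - j)) j)
        (strandCrossing s (o + (k - j) + 1) j) :=
      semiconjBy_strandCrossing fun i h1 h2 => hs.ascending_semiconj (by omega) (by omega)
        (by omega)
    rw [pow_succ, ih (by omega), show o + (k + 1 - j) = o + (k - j) + 1 by omega, mul_assoc, ← h1.eq,
      ascending_succ, pow_succ, show k + 1 - (j + 1) = k - j by omega,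
      strandCrossing, show o + (k - j) + j + 1 = o + k + 1 by omega]
    simp only [mul_assoc]

/-- Unravelling all but one of the factors `ascending` separates the twist of the old strands from
the loop of the new strand around them. -/
theorem twist_succ (hs : IsBraidSeq N s) {o k : ℕ} (hN : o + k + 1 ≤ N) :
    twist s o (k + 1) = twist s o k * (crossing s o 1 k * crossing s o k 1) := by
  rcases k with _ | k
  · simp [twist, ascending, crossing, strandCrossing]
  · rw [crossing_one_right, crossing_one_left, twist, twist, pow_succ, Nat.add_sub_cancel,
      Nat.add_sub_cancel, hs.ascending_succ_pow le_rfl (by omega), Nat.sub_self,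
      mul_assoc]
    rfl

theorem crossing_loop_commute (hs : IsBraidSeq N s) {o a b j : ℕ} (hj : o < j) (hja : j < o + a)
    (hN : o + a + b ≤ N) : Commute (crossing s o b a * crossing s o a b) (s j) :=
  (hs.crossing_semiconj_right hj hja (by omega)).mul_left (hs.crossing_semiconj_left hj hja hN)

theorem crossing_loop_commute' (hs : IsBraidSeq N s) {o a b j : ℕ} (hj : o + a < j)
    (hja : j < o + a + b) (hN : o + a + b ≤ N) :
    Commute (crossing s o b a * crossing s o a b) (s j) := by
  obtain ⟨i, rfl⟩ : ∃ i, j = i + a := ⟨j - a, by omega⟩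
  exact (hs.crossing_semiconj_left (a := b) (by omega) (by omega) (by omega)).mul_left
    (hs.crossing_semiconj_right (by omega) (by omega) hN)

/-- The full twist of two adjacent packets. -/
theorem twist_add (hs : IsBraidSeq N s) {o a b : ℕ} (hN : o + a + b ≤ N) :
    twist s o (a + b) =
      crossing s o b a * crossing s o a b * (twist s o a * twist s (o + a) b) := by
  induction b with
  | zero => simp [crossing_zero_right, crossing, twist_zero]
  | succ b ih =>
    -- The loop of the new strand around the first `a + b` strands is `C * L * C'`, where `L` is its
    -- loop around the first packet alone. The calculation moves `L` to the left; passing `crossing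
    -- s o a b * C` turns it into the loop at offset `o + b`.
    set C := crossing s (o + a) 1 b with hC
    set C' := crossing s (o + a) b 1 with hC'
    set L := crossing s o 1 a * crossing s o a 1 with hL
    have h1 : SemiconjBy C (twist s (o + a + 1) b) (twist s (o + a) b) := by
      have : SemiconjBy C⁻¹ (twist s (o + a) b) (twist s (o + a + 1) b) :=
        semiconjBy_twist fun i h1 h2 => by
          rw [SemiconjBy.inv_symm_left_iff]
          exact hs.crossing_semiconj_right h1 h2 (by omega)
      rwa [SemiconjBy.inv_symm_left_iff] at this
    have h2 : Commute L (twist s (o + a + 1) b) := commute_twist fun i h1 h2 =>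
      ((commute_crossing fun j _ _ => (hs.comm j i (by omega)).symm).mul_right
        (commute_crossing fun j _ _ => (hs.comm j i (by omega)).symm)).symm
    have h3 : Commute (twist s o a) C := commute_crossing fun j _ _ =>
      (commute_twist fun i h1 h2 => (hs.comm i j (by omega)).symm).symm
    have h4 : Commute L (twist s o a) := commute_twist fun i h1 h2 =>
      hs.crossing_loop_commute h1 h2 (by omega)
    have h5 : SemiconjBy (crossing s o a b * C)
        L (crossing s (o + b) 1 a * crossing s (o + b) a 1) := by
      rw [← crossing_add_left]
      exact (semiconjBy_crossing fun i h1 h2 =>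
        hs.crossing_semiconj_left h1 (by omega) (by omega)).mul_right
        (semiconjBy_crossing fun i h1 h2 =>
        hs.crossing_semiconj_left h1 (by omega) (by omega))
    rw [← Nat.add_assoc, hs.twist_succ (by omega), ih (by omega), hs.twist_succ (by omega),
      hs.crossing_add_right o 1 a b, crossing_add_left o a b 1, crossing_add_left o b 1 a,
      hs.crossing_add_right o a b 1]
    calc _ = crossing s o b a * (crossing s o a b * twist s o a * (twist s (o + a) b * C) * L * C') := by
          simp only [hL, hC, hC', mul_assoc]
      _ = crossing s o b a * (crossing s o a b * (twist s o a * C) * (twist s (o + a + 1) b * L) * C') := by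
          rw [← h1.eq]; simp only [mul_assoc]
      _ = crossing s o b a * ((crossing s o a b * C) * (twist s o a * L) * twist s (o + a + 1) b * C') := by
          rw [h3.eq, ← h2.eq]; simp only [mul_assoc]
      _ = crossing s o b a * ((crossing s o a b * C * L) * (twist s o a * twist s (o + a + 1) b) * C') := by
          rw [← h4.eq]; simp only [mul_assoc]
      _ = crossing s o b a * (crossing s (o + b) 1 a * crossing s (o + b) a 1) *
          (crossing s o a b * (C * twist s o a) * twist s (o + a + 1) b * C') := by
          rw [h5.eq]; simp only [mul_assoc]
      _ = crossing s o b a * (crossing s (o + b) 1 a * crossing s (o + b) a 1) *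
          (crossing s o a b * twist s o a * (C * twist s (o + a + 1) b) * C') := by
          rw [← h3.eq]; simp only [mul_assoc]
      _ = _ := by rw [h1.eq]; simp only [hC, hC', mul_assoc]

/-- The full twist of a packet commutes with all generators except the two that involve exactly one
strand of the packet. -/
theorem twist_commute (hs : IsBraidSeq N s) {o k j : ℕ} (hN : o + k ≤ N) (h1 : j ≠ o)
    (h2 : j ≠ o + k) : Commute (twist s o k) (s j) := by
  rcases Nat.lt_or_ge j o with h | h
  · exact (commute_twist fun i h1 h2 => hs.comm j i (by omega)).symm
  rcases Nat.lt_or_ge (o + k) j with h' | h'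
  · exact (commute_twist fun i h1 h2 => (hs.comm i j (by omega)).symm).symm
  induction k generalizing o with
  | zero => omega
  | succ k ih =>
    rcases Nat.lt_or_ge j (o + k) with h'' | h''
    · rw [hs.twist_succ (by omega)]
      exact (ih (by omega) h1 (by omega) h (by omega)).mul_left
        (hs.crossing_loop_commute (by omega) h'' (by omega))
    -- The last generator is not covered by the induction on the first strands, so here the first
    -- strand is split off instead of the last one.
    · obtain rfl : j = o + k := by omega
      obtain ⟨k, rfl⟩ : ∃ c, k = c + 1 := ⟨k - 1, by omega⟩
      rcases k with _ | k
      · simp only [Nat.zero_add, Nat.reduceAdd, twist_two]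
        exact (Commute.refl _).pow_left 2
      · rw [show k + 1 + 1 + 1 = 1 + (k + 2) by omega, hs.twist_add (by omega), twist_one, one_mul]
        refine Commute.mul_left ?_ (ih (by omega) (by omega) (by omega) (by omega) (by omega))
        exact hs.crossing_loop_commute' (by omega) (by omega) (by omega)

/-- Full twists of nested or disjoint packets commute. -/
theorem twist_commute_twist (hs : IsBraidSeq N s) {o k o' k' : ℕ} (hN : o + k ≤ N)
    (h : o + k ≤ o' ∨ o' + k' ≤ o ∨ (o ≤ o' ∧ o' + k' ≤ o + k)) :
    Commute (twist s o k) (twist s o' k') :=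
  commute_twist fun i _ _ => hs.twist_commute hN (by omega) (by omega)

end IsBraidSeq
end Packets

/-! ## Profinite braid groups -/

theorem IsBraidSeq.map {G H : Type*} [Group G] [Group H] {N : ℕ} {s : ℕ → G}
    (hs : IsBraidSeq N s) (φ : G →* H) : IsBraidSeq N fun i => φ (s i) where
  comm i j h := (hs.comm i j h).map φ
  braid i h1 h2 := by simp only [← map_mul, hs.braid i h1 h2]

theorem sigma_of {n i : ℕ} (h1 : 1 ≤ i) (h2 : i < n) :
    sigma n i = toCompl (Braid n) (PresentedGroup.of (⟨i - 1, by omega⟩ : Fin (n - 1))) :=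
  dif_pos ⟨h1, h2⟩

theorem sigma_of_not {n i : ℕ} (h : ¬ (1 ≤ i ∧ i < n)) : sigma n i = 1 := dif_neg h

theorem isBraidSeq_sigma (n : ℕ) : IsBraidSeq n (sigma n) where
  comm i j h := by
    by_cases hi : 1 ≤ i ∧ i < n
    · by_cases hj : 1 ≤ j ∧ j < n
      · rw [sigma_of hi.1 hi.2, sigma_of hj.1 hj.2]
        refine Commute.map (f := toCompl (Braid n)) ?_
        have : (PresentedGroup.mk (braidRels n)) _ = 1 := PresentedGroup.one_of_mem
          (rels := braidRels n) (Or.inl ⟨⟨i - 1, by omega⟩, ⟨j - 1, by omega⟩, by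
            show i - 1 + 1 < j - 1; omega, rfl⟩)
        rw [map_mul, map_inv, mul_inv_eq_one, map_mul, map_mul] at this
        exact this
      · rw [sigma_of_not hj]; exact Commute.one_right _
    · rw [sigma_of_not hi]; exact Commute.one_left _
  braid i h1 h2 := by
    rw [sigma_of h1 (by omega), sigma_of (i := i + 1) (by omega) h2]
    have : (PresentedGroup.mk (braidRels n)) _ = 1 := PresentedGroup.one_of_mem
      (rels := braidRels n) (Or.inr ⟨⟨i - 1, by omega⟩, ⟨i + 1 - 1, by omega⟩, by
        show i - 1 + 1 = i + 1 - 1; omega, rfl⟩)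
    rw [map_mul, map_inv, mul_inv_eq_one] at this
    simp only [map_mul] at this
    simp only [← map_mul]
    exact congrArg _ this

theorem fullTwist_eq (n : ℕ) (b : ℕ × ℕ) : fullTwist n b = twist (sigma n) b.1 b.2 := rfl

theorem braid_hom_ext {n : ℕ} {M : Type*} [Group M] [TopologicalSpace M] [T2Space M]
    {φ ψ : BHat n →ₜ* M} (h : ∀ i, 1 ≤ i → i < n → φ (sigma n i) = ψ (sigma n i)) : φ = ψ := by
  apply compl_hom_ext
  have : (φ : BHat n →* M).comp (toCompl (Braid n)) =
      (ψ : BHat n →* M).comp (toCompl (Braid n)) := by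
    apply PresentedGroup.ext
    intro i
    have := h (i + 1) (by omega) (by omega)
    rw [sigma_of (by omega) (by omega)] at this
    exact this
  exact DFunLike.congr_fun this


theorem exists_braid_hom {n : ℕ} {s : ℕ → P}
    (hc : ∀ i j, 1 ≤ i → i + 2 ≤ j → j < n → Commute (s i) (s j))
    (hb : ∀ i, 1 ≤ i → i + 1 < n → s i * s (i + 1) * s i = s (i + 1) * s i * s (i + 1)) :
    ∃ φ : BHat n →ₜ* P, ∀ i, 1 ≤ i → i < n → φ (sigma n i) = s i := by
  have hr : ∀ r ∈ braidRels n, FreeGroup.lift (fun i : Fin (n - 1) => s (i + 1)) r = 1 := by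
    rintro r (⟨i, j, h, rfl⟩ | ⟨i, j, h, rfl⟩)
    · rw [map_mul, map_inv, mul_inv_eq_one]
      simp only [map_mul, FreeGroup.lift_apply_of]
      exact hc _ _ (by omega) (by omega) (by omega)
    · rw [map_mul, map_inv, mul_inv_eq_one]
      simp only [map_mul, FreeGroup.lift_apply_of]
      rw [← h]
      exact hb _ (by omega) (by omega)
  refine ⟨liftCompl (PresentedGroup.toGroup hr), fun i h1 h2 => ?_⟩
  rw [sigma_of h1 h2, liftCompl_toCompl, PresentedGroup.toGroup.of]
  change s (i - 1 + 1) = s i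
  rw [Nat.sub_add_cancel h1]

theorem braid_induction {n : ℕ} {H : Subgroup (BHat n)} (hH : IsClosed (H : Set (BHat n)))
    (h : ∀ i, 1 ≤ i → i < n → sigma n i ∈ H) (x : BHat n) : x ∈ H := by
  have hr : (toCompl (Braid n)).range ≤ H := by
    rintro _ ⟨y, rfl⟩
    have : y ∈ Subgroup.closure (Set.range (PresentedGroup.of (rels := braidRels n))) := by
      rw [PresentedGroup.closure_range_of]; trivial
    induction this using Subgroup.closure_induction with
    | mem x hx =>
      obtain ⟨i, rfl⟩ := hx
      have := h (i + 1) (by omega) (by omega)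
      rwa [sigma_of (by omega) (by omega)] at this
    | one => rw [map_one]; exact H.one_mem
    | mul x y _ _ hx hy => rw [map_mul]; exact H.mul_mem hx hy
    | inv x _ hx => rw [map_inv]; exact H.inv_mem hx
  have := (denseRange_toCompl (Braid n)).closure_eq
  exact closure_minimal (s := Set.range (toCompl (Braid n))) (by
    rintro _ ⟨y, rfl⟩; exact hr ⟨y, rfl⟩) hH (this ▸ Set.mem_univ x)

/-! ## Cabling -/

/-- A finite group as a profinite group. -/
abbrev finGrp (G : Type) [Group G] [Finite G] : ProfiniteGrp.{0} :=
  ProfiniteGrp.ofFiniteGrp (FiniteGrp.of G)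

instance (G : Type) [Group G] [Finite G] : DiscreteTopology (finGrp G) := ⟨rfl⟩

/-- A homomorphism of a finite group to a profinite group is continuous. -/
def finHom {G : Type} [Group G] [Finite G] (φ : G →* Q) : finGrp G →ₜ* Q :=
  ⟨φ, continuous_of_discreteTopology⟩

/-- The sequence of the sizes of packets, extended by zeros. -/
def sizes {n N : ℕ} (u : Fin n → Fin (N + 1)) (p : ℕ) : ℕ := if h : p < n then u ⟨p, h⟩ else 0

/-- The crossing of the `i`-th packet with the next one (the packets being numbered from `0`). -/
def packetCrossing {G : Type*} [Group G] (s : ℕ → G) (i : ℕ) (v : ℕ → ℕ) : G :=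
  crossing s (∑ p ∈ Finset.range i, v p) (v i) (v (i + 1))

theorem sum_range_swap (v : ℕ → ℕ) {i k : ℕ} (h : k ≠ i + 1) :
    ∑ p ∈ Finset.range k, (v ∘ Equiv.swap i (i + 1)) p = ∑ p ∈ Finset.range k, v p := by
  rcases Nat.lt_or_ge k (i + 1) with h' | h'
  · apply Finset.sum_congr rfl
    intro p hp
    rw [Finset.mem_range] at hp
    rw [Function.comp_apply, Equiv.swap_apply_of_ne_of_ne (by omega) (by omega)]
  · apply Equiv.Perm.sum_comp (Equiv.swap i (i + 1)) (Finset.range k) v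
    intro p hp
    by_contra hk
    rw [Finset.coe_range, Set.mem_Iio] at hk
    exact hp (Equiv.swap_apply_of_ne_of_ne (by omega) (by omega))

/-! ### Packet crossings as a cocycle on arrangements -/

section

variable {G : Type*} [Group G] {s : ℕ → G} {N : ℕ}

/-- With `packetCrossing_braid`, this is what makes the crossings a cocycle over the permutation
action on sizes. Far swaps change neither the offset nor the sizes of the packets crossed. -/
theorem packetCrossing_far (hs : IsBraidSeq N s) (v : ℕ → ℕ) {i j : ℕ} (h : i + 2 ≤ j) :
    packetCrossing s i (v ∘ Equiv.swap j (j + 1)) * packetCrossing s j v =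
      packetCrossing s j (v ∘ Equiv.swap i (i + 1)) * packetCrossing s i v := by
  have hlt : ∑ p ∈ Finset.range i, v p + v i + v (i + 1) ≤ ∑ p ∈ Finset.range j, v p := by
    rw [← Finset.sum_range_succ, ← Finset.sum_range_succ]
    exact Finset.sum_le_sum_of_subset (Finset.range_mono (by omega))
  unfold packetCrossing
  rw [sum_range_swap v (by omega), sum_range_swap v (by omega)]
  simp only [Function.comp_apply]
  rw [Equiv.swap_apply_of_ne_of_ne (by omega) (by omega),
    Equiv.swap_apply_of_ne_of_ne (by omega) (by omega),
    Equiv.swap_apply_of_ne_of_ne (by omega) (by omega),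
    Equiv.swap_apply_of_ne_of_ne (by omega) (by omega)]
  exact hs.crossing_far hlt

theorem packetCrossing_braid (hs : IsBraidSeq N s) (v : ℕ → ℕ) {i : ℕ}
    (h : ∑ p ∈ Finset.range (i + 3), v p ≤ N) :
    packetCrossing s i ((v ∘ Equiv.swap i (i + 1)) ∘ Equiv.swap (i + 1) (i + 1 + 1)) *
      packetCrossing s (i + 1) (v ∘ Equiv.swap i (i + 1)) * packetCrossing s i v =
    packetCrossing s (i + 1)
        ((v ∘ Equiv.swap (i + 1) (i + 1 + 1)) ∘ Equiv.swap i (i + 1)) *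
      packetCrossing s i (v ∘ Equiv.swap (i + 1) (i + 1 + 1)) * packetCrossing s (i + 1) v := by
  simp only [packetCrossing, sum_range_swap _ (show i ≠ i + 1 by omega),
    sum_range_swap _ (show i ≠ i + 1 + 1 by omega), Finset.sum_range_succ] at h ⊢
  simp only [Function.comp_apply, Equiv.swap_apply_left, Equiv.swap_apply_right]
  have e1 : Equiv.swap i (i + 1) (i + 1 + 1) = i + 1 + 1 :=
    Equiv.swap_apply_of_ne_of_ne (by omega) (by omega)
  have e2 : Equiv.swap (i + 1) (i + 1 + 1) i = i :=
    Equiv.swap_apply_of_ne_of_ne (by omega) (by omega)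
  simp only [e1, e2, Equiv.swap_apply_left, Equiv.swap_apply_right]
  exact hs.crossing_braid h

end

section Cable

variable {n N : ℕ} {s : ℕ → Q}

theorem sizes_injective : Function.Injective (sizes (n := n) (N := N)) := by
  intro u u' h
  funext p
  have := congrFun h p
  simpa [sizes, Fin.ext_iff] using this

theorem sizes_swap (u : Fin n → Fin (N + 1)) {i : ℕ} (hi : i + 1 < n) :
    sizes (u ∘ Equiv.swap ⟨i, by omega⟩ ⟨i + 1, hi⟩) = sizes u ∘ Equiv.swap i (i + 1) := by
  funext p
  simp only [sizes, Function.comp_apply, Equiv.swap_apply_def, Fin.mk.injEq]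
  by_cases h1 : p = i
  · subst h1; simp [hi, show p < n by omega]
  by_cases h2 : p = i + 1
  · subst h2; simp [hi, show i < n by omega]
  simp [h1, h2]

/-- The crossing of the packets `i` and `i + 1`, or `1` if there are more than `N` points. -/
def cableCrossing (s : ℕ → Q) (i : ℕ) (u : Fin n → Fin (N + 1)) : Q :=
  if ∑ p ∈ Finset.range n, sizes u p ≤ N then packetCrossing s i (sizes u) else 1

/-- The action of the crossing of the packets `i` and `i + 1` on arrangements of packets, twisted by
the crossing of the strands in these packets. -/
def cablePerm (s : ℕ → Q) {i : ℕ} (hi : i + 1 < n) :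
    Equiv.Perm ((Fin n → Fin (N + 1)) × Q) :=
  Equiv.prodShear (Equiv.arrowCongr (Equiv.swap ⟨i, by omega⟩ ⟨i + 1, hi⟩) (Equiv.refl _))
    fun u => Equiv.mulLeft (cableCrossing s i u)

theorem cablePerm_apply (s : ℕ → Q) {i : ℕ} (hi : i + 1 < n) (u : Fin n → Fin (N + 1)) (x : Q) :
    cablePerm s hi (u, x) =
      (u ∘ Equiv.swap ⟨i, by omega⟩ ⟨i + 1, hi⟩, cableCrossing s i u * x) := rfl

theorem cableCrossing_of_le {i : ℕ} {u : Fin n → Fin (N + 1)}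
    (h : ∑ p ∈ Finset.range n, sizes u p ≤ N) :
    cableCrossing s i u = packetCrossing s i (sizes u) := if_pos h

theorem sum_sizes_swap (u : Fin n → Fin (N + 1)) {i : ℕ} (hi : i + 1 < n) :
    ∑ p ∈ Finset.range n, sizes (u ∘ Equiv.swap ⟨i, by omega⟩ ⟨i + 1, hi⟩) p =
      ∑ p ∈ Finset.range n, sizes u p := by
  rw [sizes_swap, sum_range_swap _ (by omega)]

/-- In the factor `Q` this is the cocycle identity. Swaps preserve the total number of points, so
the default value `1` beyond `N` points is used on both sides or on neither. -/
theorem cablePerm_comm (hs : IsBraidSeq N s) {i j : ℕ} (h : i + 2 ≤ j) (hi : i + 1 < n)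
    (hj : j + 1 < n) : Commute (cablePerm (N := N) s hi) (cablePerm s hj) := by
  apply Equiv.ext
  rintro ⟨u, x⟩
  simp only [Equiv.Perm.mul_apply, cablePerm_apply]
  refine Prod.ext (sizes_injective ?_) ?_
  · simp only [sizes_swap]
    funext p
    simp only [Function.comp_apply, Equiv.swap_apply_def]
    congr 1
    split_ifs <;> omega
  · simp only [← mul_assoc]
    congr 1
    simp only [cableCrossing, sum_sizes_swap]
    split_ifs
    · simp only [sizes_swap]
      exact packetCrossing_far hs _ h
    · rfl

theorem cablePerm_braid (hs : IsBraidSeq N s) {i : ℕ} (hi : i + 1 + 1 < n) :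
    cablePerm (N := N) s (show i + 1 < n by omega) * cablePerm s hi *
      cablePerm s (show i + 1 < n by omega) =
    cablePerm s hi * cablePerm s (show i + 1 < n by omega) * cablePerm s hi := by
  apply Equiv.ext
  rintro ⟨u, x⟩
  simp only [Equiv.Perm.mul_apply, cablePerm_apply]
  refine Prod.ext (sizes_injective ?_) ?_
  · simp only [sizes_swap]
    funext p
    simp only [Function.comp_apply, Equiv.swap_apply_def]
    congr 1
    split_ifs <;> omega
  · simp only [← mul_assoc]
    congr 1
    simp only [cableCrossing, sum_sizes_swap]
    split_ifs with hN
    · simp only [sizes_swap]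
      refine packetCrossing_braid hs _ (le_trans ?_ hN)
      exact Finset.sum_le_sum_of_subset (Finset.range_mono (by omega))
    · rfl

variable [Finite Q]

/-- The action of the braid group on `n` strands on arrangements of `n` packets, twisted by the
braids that it induces on the strands of the packets. -/
theorem exists_cabling (hs : IsBraidSeq N s) (n : ℕ) :
    ∃ ρ : BHat n →ₜ* finGrp (Equiv.Perm ((Fin n → Fin (N + 1)) × Q)),
      ∀ i (hi : i + 1 < n), ρ (sigma n (i + 1)) = cablePerm s hi := by
  -- Generators are numbered from `1` and packets from `0`, hence the shift; the value `t 0` is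
  -- irrelevant, as `exists_braid_hom` sees positive indices only.
  let t : ℕ → finGrp (Equiv.Perm ((Fin n → Fin (N + 1)) × Q)) :=
    fun i => if h : i - 1 + 1 < n then cablePerm s h else 1
  obtain ⟨ρ, hρ⟩ := exists_braid_hom (n := n) (s := t) (fun i j h1 h2 h3 => by
      obtain ⟨i, rfl⟩ : ∃ k, i = k + 1 := ⟨i - 1, by omega⟩
      obtain ⟨j, rfl⟩ : ∃ k, j = k + 1 := ⟨j - 1, by omega⟩
      have e1 : t (i + 1) = cablePerm s (show i + 1 < n by omega) := dif_pos _
      have e2 : t (j + 1) = cablePerm s (show j + 1 < n by omega) := dif_pos _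
      rw [e1, e2]
      exact cablePerm_comm hs (by omega) _ _) (fun i h1 h2 => by
      obtain ⟨i, rfl⟩ : ∃ k, i = k + 1 := ⟨i - 1, by omega⟩
      have e1 : t (i + 1) = cablePerm s (show i + 1 < n by omega) := dif_pos _
      have e2 : t (i + 1 + 1) = cablePerm s (show i + 1 + 1 < n by omega) := dif_pos _
      rw [e1, e2]
      exact cablePerm_braid hs h2)
  exact ⟨ρ, fun i hi => (hρ (i + 1) (by omega) hi).trans (dif_pos hi)⟩

/-- The cabling action of the braid group on `n` strands. -/
def cabling (hs : IsBraidSeq N s) (n : ℕ) :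
    BHat n →ₜ* finGrp (Equiv.Perm ((Fin n → Fin (N + 1)) × Q)) := (exists_cabling hs n).choose

theorem cabling_sigma (hs : IsBraidSeq N s) {i : ℕ} (hi : i + 1 < n) :
    cabling hs n (sigma n (i + 1)) = cablePerm s hi := (exists_cabling hs n).choose_spec i hi

/-- The permutation of twisted arrangements given by a braid. -/
def cablingPerm (hs : IsBraidSeq N s) (g : BHat n) : Equiv.Perm ((Fin n → Fin (N + 1)) × Q) :=
  cabling hs n g

theorem cablingPerm_mul (hs : IsBraidSeq N s) (g h : BHat n) :
    cablingPerm hs (g * h) = cablingPerm hs g * cablingPerm hs h := map_mul (cabling hs n) g h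

theorem cablingPerm_one (hs : IsBraidSeq N s) : cablingPerm hs (1 : BHat n) = 1 :=
  map_one (cabling hs n)

/-- Replacing the strands of the braid `g` by packets leads from the arrangement `u` of packets to
the arrangement `u'`, by the braid `q`. -/
def IsCabling (hs : IsBraidSeq N s) (g : BHat n) (u u' : Fin n → Fin (N + 1)) (q : Q) : Prop :=
  ∀ x : Q, cablingPerm hs g (u, x) = (u', q * x)

variable {hs : IsBraidSeq N s} {g h : BHat n} {u u' u'' : Fin n → Fin (N + 1)} {q r : Q}

theorem IsCabling.mul (hg : IsCabling hs g u' u'' q) (hh : IsCabling hs h u u' r) :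
    IsCabling hs (g * h) u u'' (q * r) := by
  intro x
  rw [cablingPerm_mul, mul_assoc, ← hg, ← hh, Equiv.Perm.mul_apply]

/-- This transfers relations: two expressions of one braid have equal cablings in `Q`. -/
theorem IsCabling.unique {u₁ u₂ : Fin n → Fin (N + 1)} (hg : IsCabling hs g u u₁ q)
    (hh : IsCabling hs g u u₂ r) : q = r := by
  have := (hg 1).symm.trans (hh 1)
  simpa using congrArg Prod.snd this

theorem isCabling_one : IsCabling hs (1 : BHat n) u u 1 := by
  intro x
  rw [cablingPerm_one, one_mul, Equiv.Perm.one_apply]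

theorem isCabling_sigma {i : ℕ} (hi : i + 1 < n) (hN : ∑ p ∈ Finset.range n, sizes u p ≤ N) :
    IsCabling hs (sigma n (i + 1)) u (u ∘ Equiv.swap ⟨i, by omega⟩ ⟨i + 1, hi⟩)
      (packetCrossing s i (sizes u)) := by
  intro x
  rw [show cablingPerm hs (sigma n (i + 1)) = cablePerm s hi from cabling_sigma hs hi]
  exact (cablePerm_apply s hi u x).trans (by rw [cableCrossing_of_le hN])

/-- The elements of a product for which the first component acts on the packets of an arrangement
by the second component. -/
def loopSubgroup (u : Fin n → Fin (N + 1)) :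
    Subgroup (finGrp (Equiv.Perm ((Fin n → Fin (N + 1)) × Q) × Q)) where
  carrier := {z | ∀ x : Q, z.1 (u, x) = (u, z.2 * x)}
  one_mem' x := by
    change (u, x) = (u, 1 * x)
    rw [one_mul]
  mul_mem' := by
    rintro ⟨π, q⟩ ⟨π', q'⟩ h h' x
    change π (π' (u, x)) = (u, q * q' * x)
    rw [show π' (u, x) = _ from h' x, show π (u, _) = _ from h _, mul_assoc]
  inv_mem' := by
    rintro ⟨π, q⟩ h x
    change π⁻¹ (u, x) = (u, q⁻¹ * x)
    rw [Equiv.Perm.inv_eq_iff_eq, show π (u, _) = _ from h _, mul_inv_cancel_left]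

variable {a b : BHat n} {p p' : Q}

/-- Pairs of a permutation and an element of `Q` that act compatibly on the arrangement `u` form a
subgroup of a finite group. It is closed, so it contains `f` evaluated at two such pairs, whose
components are the evaluations of `f` in the two factors. -/
theorem IsCabling.ev (f : F2Hat) (ha : IsCabling hs a u u p) (hb : IsCabling hs b u u p') :
    IsCabling hs (ev f a b) u u (ev f p p') := by
  let Γ := finGrp (Equiv.Perm ((Fin n → Fin (N + 1)) × Q) × Q)
  let z : Γ := (cabling hs n a, p)
  let z' : Γ := (cabling hs n b, p')
  let π₁ : Γ →ₜ* finGrp (Equiv.Perm ((Fin n → Fin (N + 1)) × Q)) :=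
    finHom (MonoidHom.fst (Equiv.Perm ((Fin n → Fin (N + 1)) × Q)) Q)
  let π₂ : Γ →ₜ* Q := finHom (MonoidHom.snd (Equiv.Perm ((Fin n → Fin (N + 1)) × Q)) Q)
  have h := ev_mem (P := Γ) (H := loopSubgroup u) (isClosed_discrete _) f (a := z) (b := z') ha hb
  have h1 : π₁ (GTBraid.ev f z z') = cabling hs n (GTBraid.ev f a b) := by
    rw [map_ev, map_ev]; rfl
  have h2 : π₂ (GTBraid.ev f z z') = GTBraid.ev f p p' := map_ev _ _ _ _
  intro x
  rw [← h2, cablingPerm, ← h1]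
  exact h x

theorem IsCabling.ppow (m : ZHat) (ha : IsCabling hs a u u p) :
    IsCabling hs (ppow a m) u u (ppow p m) := by
  let Γ := finGrp (Equiv.Perm ((Fin n → Fin (N + 1)) × Q) × Q)
  let z : Γ := (cabling hs n a, p)
  let π₁ : Γ →ₜ* finGrp (Equiv.Perm ((Fin n → Fin (N + 1)) × Q)) :=
    finHom (MonoidHom.fst (Equiv.Perm ((Fin n → Fin (N + 1)) × Q)) Q)
  let π₂ : Γ →ₜ* Q := finHom (MonoidHom.snd (Equiv.Perm ((Fin n → Fin (N + 1)) × Q)) Q)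
  have h := ppow_mem (P := Γ) (H := loopSubgroup u) (isClosed_discrete _) m (a := z) ha
  have h1 : π₁ (GTBraid.ppow z m) = cabling hs n (GTBraid.ppow a m) := by
    rw [map_ppow, map_ppow]; rfl
  have h2 : π₂ (GTBraid.ppow z m) = GTBraid.ppow p m := map_ppow _ _ _
  intro x
  rw [← h2, cablingPerm, ← h1]
  exact h x

end Cable

/-! ## The hexagon in a group with a braid relation -/

namespace GT

variable (F : GT)

/-- The image of the second of two braid generators `s`, `t` under the Drinfeld formulas. -/
def second (s t : P) : P :=
  ev F.f (t ^ 2) (s ^ 2) * ppow t F.lam * ev F.f (s ^ 2) (t ^ 2)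

section Hexagon

variable {s t : P} (h : s * t * s = t * s * t)
include h

theorem semiconj_garside : SemiconjBy (s * t * s) s t := by
  change s * t * s * s = t * (s * t * s)
  rw [h]; simp only [mul_assoc] at h ⊢; rw [h]

theorem semiconj_garside' : SemiconjBy (s * t * s) t s := by
  change s * t * s * t = s * (s * t * s)
  simp only [mul_assoc] at h ⊢; rw [h]

theorem commute_loop : Commute s (t * s ^ 2 * t) := by
  calc s * (t * s ^ 2 * t) = (s * t * s) * (s * t) := by simp only [sq, mul_assoc]
    _ = t * s * (t * s * t) := by rw [h]; simp only [mul_assoc]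
    _ = t * s ^ 2 * t * s := by rw [← h]; simp only [sq, mul_assoc]

theorem sq_mul_loop : s ^ 2 * (t * s ^ 2 * t) = (s * t * s) ^ 2 := by
  calc s ^ 2 * (t * s ^ 2 * t) = s * (s * t * s) * (s * t) := by simp only [sq, mul_assoc]
    _ = s * (t * s * t) * (s * t) := by rw [h]
    _ = s * t * s * (t * s * t) := by simp only [mul_assoc]
    _ = _ := by rw [← h, sq]

/-- This is relation (II) at `x = s²`, `y = t²`. With `D = s t s`, the third element `z` is `s y s⁻¹
D⁻²`, and `s y s⁻¹ = t⁻¹ x t`. As `D²` is central in the group generated by `s` and `t`, it drops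
out of `f`, so that `f(z,x)` and `f(y,z)` are conjugates of `f(y,x)` by `s` and `t⁻¹`; only the
power `z^m` retains a trace of `D²`. -/
theorem hexagon_cyclic :
    ppow s F.lam * ev F.f (t ^ 2) (s ^ 2) * ppow t F.lam * (s * t * s)⁻¹ *
      ev F.f (t ^ 2) (s ^ 2) * ppow t F.lam * ev F.f (s ^ 2) (t ^ 2) =
    ppow ((s * t * s) ^ 2) F.half := by
  obtain ⟨D, hD⟩ : ∃ D, D = s * t * s := ⟨_, rfl⟩
  obtain ⟨x, hx⟩ : ∃ x, x = s ^ 2 := ⟨_, rfl⟩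
  obtain ⟨y, hy⟩ : ∃ y, y = t ^ 2 := ⟨_, rfl⟩
  rw [← hD, ← hx, ← hy]
  have hDs : SemiconjBy D s t := hD ▸ semiconj_garside h
  have hDt : SemiconjBy D t s := hD ▸ semiconj_garside' h
  have hTs : Commute (D ^ 2) s := by rw [sq]; exact hDt.mul_left hDs
  have hTt : Commute (D ^ 2) t := by rw [sq]; exact hDs.mul_left hDt
  have hTx : Commute (D ^ 2) x := hx ▸ hTs.pow_right 2
  have hTy : Commute (D ^ 2) y := hy ▸ hTt.pow_right 2
  have hz2 : s * y * s⁻¹ = t⁻¹ * x * t := by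
    rw [mul_inv_eq_iff_eq_mul, mul_assoc, mul_assoc, eq_inv_mul_iff_mul_eq, hx, hy]
    calc t * (s * t ^ 2) = t * s * t * t := by simp only [sq, mul_assoc]
      _ = s * t * s * t := by rw [h]
      _ = s * (t * s * t) := by simp only [mul_assoc]
      _ = s ^ 2 * (t * s) := by rw [← h]; simp only [sq, mul_assoc]
  have hz1 : (x * y)⁻¹ = (s * y * s⁻¹) * (D ^ 2)⁻¹ := by
    rw [eq_mul_inv_iff_mul_eq, inv_mul_eq_iff_eq_mul, hz2, hD, ← sq_mul_loop h, hx, hy]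
    simp [sq, mul_assoc]
  have hTz : Commute (D ^ 2) (s * y * s⁻¹) := (hTs.mul_right hTy).mul_right hTs.inv_right
  have key := F.hexagon x y (x * y)⁻¹ (mul_inv_cancel _)
  have k1 : ev F.f (x * y)⁻¹ x = s * ev F.f y x * s⁻¹ := by
    rw [hz1, ← conj_ev]
    conv_lhs => rw [← mul_one x]
    rw [F.ev_mul_central hTz.symm.inv_right (Commute.one_right _) hTx.symm.inv_right
      (Commute.one_right _) (Commute.one_right _)]
    congr 1
    rw [eq_mul_inv_iff_mul_eq, hx, sq, mul_assoc]
  have k2 : ev F.f y (x * y)⁻¹ = t⁻¹ * ev F.f y x * t := by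
    rw [hz1]
    have := F.ev_mul_central (a := y) (b := s * y * s⁻¹) (c := 1) (d := (D ^ 2)⁻¹)
      (Commute.one_right _) hTy.symm.inv_right (Commute.one_right _)
      hTz.symm.inv_right (Commute.one_left _)
    rw [mul_one] at this
    rw [this, hz2]
    have := conj_ev F.f t⁻¹ y x
    rw [inv_inv] at this
    rw [← this]
    congr 1
    rw [mul_assoc, eq_inv_mul_iff_mul_eq, hy, sq, mul_assoc]
  have k3 : ppow (x * y)⁻¹ F.half = s * ppow y F.half * s⁻¹ * (ppow (D ^ 2) F.half)⁻¹ := by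
    rw [hz1, ppow_mul_of_commute hTz.symm.inv_right, conj_ppow, ppow_inv]
  have hC : ∀ w, Commute (D ^ 2) w → Commute (ppow (D ^ 2) F.half) w := fun w hw =>
    (commute_ppow _ hw.symm).symm
  have hDt' : s⁻¹ * t⁻¹ = t * D⁻¹ := by
    rw [hD, h]; simp [mul_assoc]
  rw [k1, k2, k3] at key
  obtain ⟨g, hg⟩ : ∃ g, g = ev F.f x y := ⟨_, rfl⟩
  obtain ⟨g', hg'⟩ : ∃ g, g = ev F.f y x := ⟨_, rfl⟩
  obtain ⟨a, ha⟩ : ∃ a, a = ppow x F.half := ⟨_, rfl⟩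
  obtain ⟨b, hb⟩ : ∃ b, b = ppow y F.half := ⟨_, rfl⟩
  obtain ⟨T, hT⟩ : ∃ b, b = ppow (D ^ 2) F.half := ⟨_, rfl⟩
  have hTt : Commute T t := hT ▸ hC _ hTt
  have hTg : Commute T g := hT ▸ hg ▸ hC _ (commute_ev F.f hTx hTy)
  have hTg' : Commute T g' := hT ▸ hg' ▸ hC _ (commute_ev F.f hTy hTx)
  have hTb : Commute T b := hT ▸ hb ▸ hC _ (commute_ppow _ hTy)
  have hbt : Commute t b := hb ▸ commute_ppow _ (hy ▸ (Commute.refl t).pow_right 2)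
  have hl : ppow t F.lam = b * t := by rw [hb, hy, F.ppow_lam']
  have hl' : ppow s F.lam = a * s := by rw [ha, hx, F.ppow_lam']
  rw [hl, hl']
  rw [← hg, ← hg', ← hT]
  have hm : Commute T⁻¹ (t⁻¹ * g' * t * b) :=
    (((hTt.inv_right.mul_right hTg').mul_right hTt).mul_right hTb).inv_left
  have k4 : g * (a * s * g' * b * (s⁻¹ * t⁻¹) * g' * t * b) * T⁻¹ = 1 := by
    calc _ = g * (a * s * g' * b * s⁻¹ * ((t⁻¹ * g' * t * b) * T⁻¹)) := by simp only [mul_assoc]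
      _ = g * a * (s * g' * s⁻¹) * (s * b * s⁻¹ * T⁻¹) * (t⁻¹ * g' * t) * b := by
        rw [← hm.eq]; simp [mul_assoc]
      _ = 1 := by rw [hg, hg', ha, hb, hT]; exact key
  rw [mul_inv_eq_one, ← eq_inv_mul_iff_mul_eq, ← hTg.inv_right.eq, eq_mul_inv_iff_mul_eq, hDt'] at k4
  rw [← k4, ← hbt.eq]
  simp only [mul_assoc]
  rw [hbt.left_comm]

/-- The Drinfeld formulas for two generators are compatible with the braid relation. -/
theorem second_garside :
    ppow s F.lam * F.second s t * ppow s F.lam =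
      ppow ((s * t * s) ^ 2) F.half * (s * t * s) * ev F.f (s ^ 2) (t ^ 2) := by
  rw [← F.hexagon_cyclic h]
  have hDs := semiconj_garside h
  have hDt := semiconj_garside' h
  -- Conjugation by `s t s` exchanges `s` and `t`, which moves the factor `(s t s)⁻¹` of
  -- `hexagon_cyclic` through the last three factors there.
  have h1 : SemiconjBy (s * t * s) (ev F.f (s ^ 2) (t ^ 2) * ppow s F.lam * ev F.f (t ^ 2) (s ^ 2))
      (F.second s t) := by
    refine SemiconjBy.mul_right (SemiconjBy.mul_right ?_ ?_) ?_
    · exact semiconjBy_ev _ (hDs.pow_right 2) (hDt.pow_right 2)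
    · exact semiconjBy_ppow _ hDs
    · exact semiconjBy_ev _ (hDt.pow_right 2) (hDs.pow_right 2)
  have h2 : (s * t * s)⁻¹ * F.second s t = ev F.f (s ^ 2) (t ^ 2) * ppow s F.lam *
      ev F.f (t ^ 2) (s ^ 2) * (s * t * s)⁻¹ := by
    rw [inv_mul_eq_iff_eq_mul, ← mul_assoc, eq_mul_inv_iff_mul_eq]
    exact h1.eq.symm
  have h3 := F.ev_symm_mul (t ^ 2) (s ^ 2)
  calc _ = ppow s F.lam * F.second s t * ppow s F.lam * (ev F.f (t ^ 2) (s ^ 2) *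
        ((s * t * s)⁻¹ * (s * t * s)) * ev F.f (s ^ 2) (t ^ 2)) := by
        rw [inv_mul_cancel, mul_one, h3, mul_one]
    _ = ppow s F.lam * ev F.f (t ^ 2) (s ^ 2) * ppow t F.lam *
        (ev F.f (s ^ 2) (t ^ 2) * ppow s F.lam * ev F.f (t ^ 2) (s ^ 2) * (s * t * s)⁻¹) *
        (s * t * s) * ev F.f (s ^ 2) (t ^ 2) := by
        simp only [second, mul_assoc]
    _ = _ := by
        rw [← h2]
        simp only [second, mul_assoc]

/-- Conjugating `second_garside` by `s t s` exchanges the roles of `s` and `t`; conjugating further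
by `f(t², s²)` gives the product on the left. -/
theorem second_garside' :
    F.second s t * ppow s F.lam * F.second s t =
      ppow ((s * t * s) ^ 2) F.half * (s * t * s) * ev F.f (s ^ 2) (t ^ 2) := by
  have hDs := semiconj_garside h
  have hDt := semiconj_garside' h
  have h3 := F.ev_symm_mul (t ^ 2) (s ^ 2)
  have hsl : SemiconjBy (s * t * s) (F.second s t)
      (ev F.f (s ^ 2) (t ^ 2) * ppow s F.lam * ev F.f (t ^ 2) (s ^ 2)) := by
    refine SemiconjBy.mul_right (SemiconjBy.mul_right ?_ ?_) ?_
    · exact semiconjBy_ev _ (hDt.pow_right 2) (hDs.pow_right 2)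
    · exact semiconjBy_ppow _ hDt
    · exact semiconjBy_ev _ (hDs.pow_right 2) (hDt.pow_right 2)
  have hl : SemiconjBy (s * t * s) (ppow s F.lam) (ppow t F.lam) := semiconjBy_ppow _ hDs
  have e := (hl.mul_right hsl).mul_right hl
  rw [F.second_garside h] at e
  have hT : Commute (s * t * s) (ppow ((s * t * s) ^ 2) F.half) :=
    commute_ppow _ ((Commute.refl _).pow_right 2)
  have hTs : Commute ((s * t * s) ^ 2) s := by rw [sq]; exact hDt.mul_left hDs
  have hTt : Commute ((s * t * s) ^ 2) t := by rw [sq]; exact hDs.mul_left hDt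
  have hTg : Commute (ppow ((s * t * s) ^ 2) F.half) (ev F.f (t ^ 2) (s ^ 2)) :=
    (commute_ppow _ (commute_ev F.f (hTt.pow_right 2) (hTs.pow_right 2)).symm).symm
  have hDg : SemiconjBy (s * t * s) (ev F.f (s ^ 2) (t ^ 2)) (ev F.f (t ^ 2) (s ^ 2)) :=
    semiconjBy_ev _ (hDs.pow_right 2) (hDt.pow_right 2)
  have e' := (SemiconjBy.mul_right (SemiconjBy.mul_right hT (Commute.refl (s * t * s))) hDg).eq
  have e2 := mul_right_cancel (e.eq.symm.trans e')
  calc F.second s t * ppow s F.lam * F.second s t =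
      ev F.f (t ^ 2) (s ^ 2) * (ppow t F.lam * (ev F.f (s ^ 2) (t ^ 2) * ppow s F.lam *
        ev F.f (t ^ 2) (s ^ 2)) * ppow t F.lam) * ev F.f (s ^ 2) (t ^ 2) := by
        simp only [second, mul_assoc]
    _ = ev F.f (t ^ 2) (s ^ 2) * ppow ((s * t * s) ^ 2) F.half * (s * t * s) *
        (ev F.f (t ^ 2) (s ^ 2) * ev F.f (s ^ 2) (t ^ 2)) := by
        rw [e2]; simp only [mul_assoc]
    _ = _ := by
        rw [h3, mul_one, ← hTg.eq, mul_assoc, ← hDg.eq, ← mul_assoc]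

theorem second_braid :
    ppow s F.lam * F.second s t * ppow s F.lam = F.second s t * ppow s F.lam * F.second s t :=
  (F.second_garside h).trans (F.second_garside' h).symm

theorem ppow_garside : ppow ((s * t * s) ^ 2) F.half =
    ppow (s ^ 2) F.half * ppow (t * s ^ 2 * t) F.half := by
  rw [← sq_mul_loop h, ppow_mul_of_commute]
  exact (commute_loop h).pow_left 2

/-- The Drinfeld action on the crossing of one strand with a packet of two strands. -/
theorem second_mul :
    F.second s t * ppow s F.lam =
      ppow (t * s ^ 2 * t) F.half * (t * s) * ev F.f (s ^ 2) (t ^ 2) := by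
  have hc : Commute s (ppow (t * s ^ 2 * t) F.half) := commute_ppow _ (commute_loop h)
  -- After multiplication by `s^λ` the left side is the one of `second_garside`, and the factor
  -- `s^(2m)` of the power of the squared Garside element supplies `s^λ` on the right.
  apply mul_left_cancel (a := ppow s F.lam)
  rw [← mul_assoc, F.second_garside h, F.ppow_garside h, F.ppow_lam']
  calc _ = ppow (s ^ 2) F.half * (ppow (t * s ^ 2 * t) F.half * s) * (t * s) *
        ev F.f (s ^ 2) (t ^ 2) := by simp only [mul_assoc]
    _ = _ := by rw [← hc.eq]; simp only [mul_assoc]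

/-- The Drinfeld action on the crossing of a packet of two strands with one strand. -/
theorem mul_second :
    ppow s F.lam * F.second s t =
      ev F.f (t ^ 2) (s ^ 2) * (s * t) * ppow (t * s ^ 2 * t) F.half := by
  have hc : Commute s (ppow (t * s ^ 2 * t) F.half) := commute_ppow _ (commute_loop h)
  have hc' : Commute (ppow (s ^ 2) F.half) (ppow (t * s ^ 2 * t) F.half) :=
    commute_ppow _ (commute_ppow _ ((commute_loop h).pow_left 2).symm).symm
  have hDs := semiconj_garside h
  have hDt := semiconj_garside' h
  have hDg : SemiconjBy (s * t * s) (ev F.f (s ^ 2) (t ^ 2)) (ev F.f (t ^ 2) (s ^ 2)) :=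
    semiconjBy_ev _ (hDs.pow_right 2) (hDt.pow_right 2)
  have hTs : Commute ((s * t * s) ^ 2) s := by rw [sq]; exact hDt.mul_left hDs
  have hTt : Commute ((s * t * s) ^ 2) t := by rw [sq]; exact hDs.mul_left hDt
  have hT : Commute (s * t * s) (ppow ((s * t * s) ^ 2) F.half) :=
    commute_ppow _ ((Commute.refl _).pow_right 2)
  have hTg : Commute (ppow ((s * t * s) ^ 2) F.half) (ev F.f (t ^ 2) (s ^ 2)) :=
    (commute_ppow _ (commute_ev F.f (hTt.pow_right 2) (hTs.pow_right 2)).symm).symm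
  apply mul_right_cancel (b := ppow s F.lam)
  rw [F.second_garside h, mul_assoc, hDg.eq, ← mul_assoc, hTg.eq, mul_assoc, ← hT.eq,
    F.ppow_garside h, F.ppow_lam, hc'.eq]
  generalize ppow (t * s ^ 2 * t) F.half = E at hc
  simp only [mul_assoc]
  rw [hc.left_comm]

end Hexagon
end GT

/-! ## The pentagon and the hexagon for packets -/

section Loops

variable {G : Type*} [Group G] {N : ℕ} {s : ℕ → G}

/-- The first two lines are the cabling of a full twist of three strands; the remaining factors on
the left are the internal twists by which it falls short of the full twist of the union. -/
theorem IsBraidSeq.twist_three (hs : IsBraidSeq N s) {o k a b : ℕ} (hN : o + k + a + b ≤ N) :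
    crossing s o a k * crossing s o k a *
        (crossing s (o + k) b a * crossing s o b k * (crossing s o k b * crossing s (o + k) a b)) *
      (twist s o k * twist s (o + k) a * twist s (o + k + a) b) = twist s o (k + a + b) := by
  have hc : Commute (crossing s o b (k + a) * crossing s o (k + a) b)
      (crossing s o a k * crossing s o k a) :=
    (commute_crossing fun i h1 h2 => hs.crossing_loop_commute h1 (by omega) (by omega)).mul_right
      (commute_crossing fun i h1 h2 => hs.crossing_loop_commute h1 (by omega) (by omega))
  rw [hs.twist_add (by omega), hs.twist_add (b := a) (by omega), ← hs.crossing_add_right,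
    ← crossing_add_left, ← hc.eq]
  simp only [mul_assoc, Nat.add_assoc]

end Loops

namespace GT

variable (F : GT)

/-- Meant for `q` a cabled twist, `T` the full twist of the union of its packets, and `z` the
product of the internal twists. -/
theorem ev_congr_central {q q' z z' T T' : P} (h : q * z = T) (h' : q' * z' = T')
    (hzT : Commute z T) (hzT' : Commute z T') (hz'T : Commute z' T) (hz'T' : Commute z' T')
    (hzz' : Commute z z') : ev F.f q q' = ev F.f T T' := by
  rw [← eq_mul_inv_iff_mul_eq] at h h'
  rw [h, h', F.ev_mul_central hzT.inv_left.symm hz'T.inv_left.symm hzT'.inv_left.symm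
    hz'T'.inv_left.symm hzz'.inv_left.inv_right]

end GT

section

variable {N : ℕ} {s : ℕ → Q} [Finite Q] {hs : IsBraidSeq N s}

theorem sizes_four (k a b c : Fin (N + 1)) :
    sizes ![k, a, b, c] 0 = k ∧ sizes ![k, a, b, c] 1 = a ∧ sizes ![k, a, b, c] 2 = b ∧
      sizes ![k, a, b, c] 3 = c := ⟨rfl, rfl, rfl, rfl⟩

theorem sizes_three (a b c : Fin (N + 1)) :
    sizes ![a, b, c] 0 = a ∧ sizes ![a, b, c] 1 = b ∧ sizes ![a, b, c] 2 = c := ⟨rfl, rfl, rfl⟩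

/-! ### Cablings of the braids in the pentagon by four packets -/

section four

variable (k a b c : Fin (N + 1)) (h : (k : ℕ) + a + b + c ≤ N)
include h

theorem sum_sizes_four : ∑ p ∈ Finset.range 4, sizes ![k, a, b, c] p ≤ N := by
  obtain ⟨h0, h1, h2, h3⟩ := sizes_four k a b c
  simpa only [Finset.sum_range_succ, Finset.sum_range_zero, Nat.zero_add, h0, h1, h2, h3] using h

theorem isCabling_four_one :
    IsCabling hs (sigma 4 1) ![k, a, b, c] ![a, k, b, c] (crossing s 0 k a) := by
  have := isCabling_sigma (hs := hs) (i := 0) (by decide) (sum_sizes_four k a b c h)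
  convert this using 1
  · ext p; fin_cases p <;> rfl
  · rfl

theorem isCabling_four_two :
    IsCabling hs (sigma 4 2) ![k, a, b, c] ![k, b, a, c] (crossing s k a b) := by
  have := isCabling_sigma (hs := hs) (i := 1) (by decide) (sum_sizes_four k a b c h)
  convert this using 1
  · ext p; fin_cases p <;> rfl
  · obtain ⟨h0, h1, h2, h3⟩ := sizes_four k a b c
    simp only [packetCrossing, Finset.sum_range_succ, Finset.sum_range_zero, Nat.zero_add,
      h0, h1, h2]

theorem isCabling_four_three :
    IsCabling hs (sigma 4 3) ![k, a, b, c] ![k, a, c, b] (crossing s (k + a) b c) := by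
  have := isCabling_sigma (hs := hs) (i := 2) (by decide) (sum_sizes_four k a b c h)
  convert this using 1
  · ext p; fin_cases p <;> rfl
  · obtain ⟨h0, h1, h2, h3⟩ := sizes_four k a b c
    simp only [packetCrossing, Finset.sum_range_succ, Finset.sum_range_zero, Nat.zero_add,
      Nat.reduceAdd, h0, h1, h2, h3]

theorem isCabling_twist_zero_two : IsCabling hs (twist (sigma 4) 0 2) ![k, a, b, c] ![k, a, b, c]
    (crossing s 0 a k * crossing s 0 k a) := by
  rw [twist_two, sq]
  exact (isCabling_four_one a k b c (by omega)).mul (isCabling_four_one k a b c h)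

theorem isCabling_twist_one_two : IsCabling hs (twist (sigma 4) 1 2) ![k, a, b, c] ![k, a, b, c]
    (crossing s k b a * crossing s k a b) := by
  rw [twist_two, sq]
  exact (isCabling_four_two k b a c (by omega)).mul (isCabling_four_two k a b c h)

theorem isCabling_twist_two_two : IsCabling hs (twist (sigma 4) 2 2) ![k, a, b, c] ![k, a, b, c]
    (crossing s (k + a) c b * crossing s (k + a) b c) := by
  rw [twist_two, sq]
  exact (isCabling_four_three k a c b (by omega)).mul (isCabling_four_three k a b c h)

theorem isCabling_twist_zero_three :
    IsCabling hs (twist (sigma 4) 0 3) ![k, a, b, c] ![k, a, b, c]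
      (crossing s 0 a k * crossing s 0 k a * (crossing s k b a * crossing s 0 b k *
        (crossing s 0 k b * crossing s k a b))) := by
  rw [(isBraidSeq_sigma 4).twist_succ (by decide)]
  refine (isCabling_twist_zero_two k a b c h).mul ?_
  simp only [crossing, strandCrossing, one_mul, mul_one]
  -- Halfway along its loop around the first two packets, the third packet stands to the left of
  -- both.
  refine IsCabling.mul (u' := ![b, k, a, c]) ?_ ?_
  · exact (isCabling_four_two k b a c (by omega)).mul (isCabling_four_one b k a c (by omega))
  · exact (isCabling_four_one k b a c (by omega)).mul (isCabling_four_two k a b c (by omega))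

theorem isCabling_twist_one_three :
    IsCabling hs (twist (sigma 4) 1 3) ![k, a, b, c] ![k, a, b, c]
      (crossing s k b a * crossing s k a b * (crossing s (k + a) c b * crossing s k c a *
        (crossing s k a c * crossing s (k + a) b c))) := by
  rw [(isBraidSeq_sigma 4).twist_succ (by decide)]
  refine (isCabling_twist_one_two k a b c h).mul ?_
  simp only [crossing, strandCrossing, one_mul, mul_one]
  refine IsCabling.mul (u' := ![k, c, a, b]) ?_ ?_
  · exact (isCabling_four_three k a c b (by omega)).mul (isCabling_four_two k c a b (by omega))
  · exact (isCabling_four_two k a c b (by omega)).mul (isCabling_four_three k a b c (by omega))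

end four

/-- Both sides of relation (III) are one braid on four strands, so their cablings by `k, a, b, c`
agree; nested and disjoint twists commute, which allows each cabled twist to be completed to a full
twist inside `f`. -/
theorem GT.pentagon_finite (F : GT) (hs : IsBraidSeq N s) {k a b c : ℕ} (h : k + a + b + c ≤ N) :
    ev F.f (twist s 0 (k + a)) (twist s k (a + b + c)) *
        ev F.f (twist s 0 (k + a + b)) (twist s (k + a) (b + c)) =
      ev F.f (twist s k (a + b)) (twist s (k + a) (b + c)) *
        ev F.f (twist s 0 (k + a + b)) (twist s k (a + b + c)) *
        ev F.f (twist s 0 (k + a)) (twist s k (a + b)) := by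
  obtain ⟨k, rfl⟩ : ∃ i : Fin (N + 1), (i : ℕ) = k := ⟨⟨k, by omega⟩, rfl⟩
  obtain ⟨a, rfl⟩ : ∃ i : Fin (N + 1), (i : ℕ) = a := ⟨⟨a, by omega⟩, rfl⟩
  obtain ⟨b, rfl⟩ : ∃ i : Fin (N + 1), (i : ℕ) = b := ⟨⟨b, by omega⟩, rfl⟩
  obtain ⟨c, rfl⟩ : ∃ i : Fin (N + 1), (i : ℕ) = c := ⟨⟨c, by omega⟩, rfl⟩
  have c12 := isCabling_twist_zero_two (hs := hs) k a b c h
  have c23 := isCabling_twist_one_two (hs := hs) k a b c h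
  have c34 := isCabling_twist_two_two (hs := hs) k a b c h
  have c123 := isCabling_twist_zero_three (hs := hs) k a b c h
  have c234 := isCabling_twist_one_three (hs := hs) k a b c h
  have e12 := (hs.twist_add (o := 0) (a := k) (b := a) (by omega)).symm
  have e23 := (hs.twist_add (o := k) (a := a) (b := b) (by omega)).symm
  have e34 := (hs.twist_add (o := k + a) (a := b) (b := c) (by omega)).symm
  have e123 := hs.twist_three (o := 0) (k := k) (a := a) (b := b) (by omega)
  have e234 := hs.twist_three (o := k) (k := a) (a := b) (b := c) (by omega)
  rw [Nat.zero_add] at e12 e123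
  have hp := F.rel_three
  simp only [fullTwist_eq] at hp
  have l := (c12.ev F.f c234).mul (c123.ev F.f c34)
  have r := ((c23.ev F.f c34).mul (c123.ev F.f c234)).mul (c12.ev F.f c23)
  rw [hp] at l
  have key := l.unique r
  have t : ∀ {o k o' k' : ℕ}, o + k ≤ N → o + k ≤ o' ∨ o' + k' ≤ o ∨ (o ≤ o' ∧ o' + k' ≤ o + k) →
    Commute (twist s o k) (twist s o' k') := fun h h' => hs.twist_commute_twist h h'
  have t' : ∀ {o k o' k' : ℕ}, o' + k' ≤ N →
    o' + k' ≤ o ∨ o + k ≤ o' ∨ (o' ≤ o ∧ o + k ≤ o' + k') →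
    Commute (twist s o k) (twist s o' k') := fun h h' => (hs.twist_commute_twist h h').symm
  rw [F.ev_congr_central e12 e234, F.ev_congr_central e123 e34, F.ev_congr_central e23 e34,
    F.ev_congr_central e123 e234, F.ev_congr_central e12 e23] at key
  · exact key
  all_goals
    repeat' first | apply Commute.mul_left | apply Commute.mul_right
    all_goals
      first
      | exact t (by omega) (by omega)
      | exact t' (by omega) (by omega)

end

/-- The pentagon relation for packets of `k`, `a`, `b` and `c` strands. -/
theorem GT.pentagon (F : GT) {s : ℕ → P} {N : ℕ} (hs : IsBraidSeq N s) {k a b c : ℕ}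
    (h : k + a + b + c ≤ N) :
    ev F.f (twist s 0 (k + a)) (twist s k (a + b + c)) *
        ev F.f (twist s 0 (k + a + b)) (twist s (k + a) (b + c)) =
      ev F.f (twist s k (a + b)) (twist s (k + a) (b + c)) *
        ev F.f (twist s 0 (k + a + b)) (twist s k (a + b + c)) *
        ev F.f (twist s 0 (k + a)) (twist s k (a + b)) := by
  apply eq_of_forall_finite
  intro Q _ φ
  have hm : ∀ o k, φ (twist s o k) = twist (fun i => φ (s i)) o k :=
    fun o k => map_twist (φ : P →* Q) s o k
  simp only [map_mul, map_ev, hm]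
  exact F.pentagon_finite (hs.map (φ : P →* Q)) h

/-! ### Cablings of the braids in the hexagon by three packets -/

section Three

variable {N : ℕ} {s : ℕ → Q} [Finite Q] {hs : IsBraidSeq N s}
variable (a b c : Fin (N + 1)) (h : (a : ℕ) + b + c ≤ N)
include h

theorem sum_sizes_three : ∑ p ∈ Finset.range 3, sizes ![a, b, c] p ≤ N := by
  obtain ⟨h0, h1, h2⟩ := sizes_three a b c
  simpa only [Finset.sum_range_succ, Finset.sum_range_zero, Nat.zero_add, h0, h1, h2] using h

theorem isCabling_three_one :
    IsCabling hs (sigma 3 1) ![a, b, c] ![b, a, c] (crossing s 0 a b) := by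
  have := isCabling_sigma (hs := hs) (i := 0) (by decide) (sum_sizes_three a b c h)
  convert this using 1
  · ext p; fin_cases p <;> rfl
  · rfl

theorem isCabling_three_two :
    IsCabling hs (sigma 3 2) ![a, b, c] ![a, c, b] (crossing s a b c) := by
  have := isCabling_sigma (hs := hs) (i := 1) (by decide) (sum_sizes_three a b c h)
  convert this using 1
  · ext p; fin_cases p <;> rfl
  · obtain ⟨h0, h1, h2⟩ := sizes_three a b c
    simp only [packetCrossing, Finset.sum_range_succ, Finset.sum_range_zero, Nat.zero_add,
      h0, h1, h2]

theorem isCabling_three_one_sq :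
    IsCabling hs (sigma 3 1 ^ 2) ![a, b, c] ![a, b, c] (crossing s 0 b a * crossing s 0 a b) := by
  rw [sq]
  exact (isCabling_three_one b a c (by omega)).mul (isCabling_three_one a b c h)

theorem isCabling_three_two_sq :
    IsCabling hs (sigma 3 2 ^ 2) ![a, b, c] ![a, b, c] (crossing s a c b * crossing s a b c) := by
  rw [sq]
  exact (isCabling_three_two a c b (by omega)).mul (isCabling_three_two a b c h)

end Three

/-- The identity being cabled is `second_mul` for two generators. It permutes the packets from `a,
b, c` through `b, a, c` to `b, c, a`, so its three associators and its powers are evaluated at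
different arrangements, each fixed by the arguments concerned. -/
theorem GT.hexagon_packets_finite (F : GT) {N : ℕ} {s : ℕ → Q} [Finite Q] (hs : IsBraidSeq N s)
    {a b c : ℕ} (h : a + b + c ≤ N) :
    ev F.f (twist s b (c + a)) (twist s 0 (b + c)) *
        (crossing s b a c * ppow (crossing s b c a * crossing s b a c) F.half) *
        ev F.f (twist s 0 (b + a)) (twist s b (a + c)) *
        (crossing s 0 a b * ppow (crossing s 0 b a * crossing s 0 a b) F.half) =
      ppow (crossing s 0 a (b + c) * crossing s 0 (b + c) a) F.half * crossing s 0 a (b + c) *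
        ev F.f (twist s 0 (a + b)) (twist s a (b + c)) := by
  obtain ⟨a, rfl⟩ : ∃ i : Fin (N + 1), (i : ℕ) = a := ⟨⟨a, by omega⟩, rfl⟩
  obtain ⟨b, rfl⟩ : ∃ i : Fin (N + 1), (i : ℕ) = b := ⟨⟨b, by omega⟩, rfl⟩
  obtain ⟨c, rfl⟩ : ∃ i : Fin (N + 1), (i : ℕ) = c := ⟨⟨c, by omega⟩, rfl⟩
  have hbr := (isBraidSeq_sigma 3).braid 1 le_rfl (by decide)
  have key := F.second_mul hbr
  rw [second, F.ppow_lam, F.ppow_lam] at key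
  have x1 := isCabling_three_one_sq (hs := hs) b c a (by omega)
  have y1 := isCabling_three_two_sq (hs := hs) b c a (by omega)
  have x2 := isCabling_three_one_sq (hs := hs) b a c (by omega)
  have y2 := isCabling_three_two_sq (hs := hs) b a c (by omega)
  have x3 := isCabling_three_one_sq (hs := hs) a b c (by omega)
  have y3 := isCabling_three_two_sq (hs := hs) a b c (by omega)
  have s1 := isCabling_three_one (hs := hs) a b c (by omega)
  have s2 := isCabling_three_two (hs := hs) b a c (by omega)
  have s3 := isCabling_three_two (hs := hs) b c a (by omega)
  have l := (((y1.ev F.f x1).mul (s2.mul (y2.ppow F.half))).mul (x2.ev F.f y2)).mul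
    (s1.mul (x3.ppow F.half))
  have r := (((s2.mul x2).mul s3).ppow F.half).mul (s2.mul s1) |>.mul (x3.ev F.f y3)
  rw [key] at l
  have key := l.unique r
  have t : ∀ {o k o' k' : ℕ}, o + k ≤ N → o + k ≤ o' ∨ o' + k' ≤ o ∨ (o ≤ o' ∧ o' + k' ≤ o + k) →
    Commute (twist s o k) (twist s o' k') := fun h h' => hs.twist_commute_twist h h'
  have t' : ∀ {o k o' k' : ℕ}, o' + k' ≤ N →
    o' + k' ≤ o ∨ o + k ≤ o' ∨ (o' ≤ o ∧ o + k ≤ o' + k') →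
    Commute (twist s o k) (twist s o' k') := fun h h' => (hs.twist_commute_twist h h').symm
  have ex1 := (hs.twist_add (o := 0) (a := b) (b := c) (by omega)).symm
  have ey1 := (hs.twist_add (o := b) (a := c) (b := a) (by omega)).symm
  have ex2 := (hs.twist_add (o := 0) (a := b) (b := a) (by omega)).symm
  have ey2 := (hs.twist_add (o := b) (a := a) (b := c) (by omega)).symm
  have ex3 := (hs.twist_add (o := 0) (a := a) (b := b) (by omega)).symm
  have ey3 := (hs.twist_add (o := a) (a := b) (b := c) (by omega)).symm
  rw [Nat.zero_add] at ex1 ex2 ex3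
  rw [F.ev_congr_central ey1 ex1, F.ev_congr_central ex2 ey2, F.ev_congr_central ex3 ey3] at key
  · have e1 : crossing s b a c * crossing s 0 a b = crossing s 0 a (b + c) := by
      rw [hs.crossing_add_right, Nat.zero_add]
    have e2 : crossing s 0 b a * crossing s b c a = crossing s 0 (b + c) a := by
      rw [crossing_add_left, Nat.zero_add]
    have e3 : crossing s b a c * (crossing s 0 a b * crossing s 0 b a) * crossing s b c a =
        crossing s 0 a (b + c) * crossing s 0 (b + c) a := by
      rw [← e1, ← e2]; simp only [mul_assoc]
    rw [e1, e3] at key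
    exact key
  all_goals
    repeat' first | apply Commute.mul_left | apply Commute.mul_right
    all_goals
      first
      | exact t (by omega) (by omega)
      | exact t' (by omega) (by omega)

/-- The hexagon relation for packets of `a`, `b` and `c` strands. -/
theorem GT.hexagon_packets (F : GT) {N : ℕ} {s : ℕ → P} (hs : IsBraidSeq N s)
    {a b c : ℕ} (h : a + b + c ≤ N) :
    ev F.f (twist s b (c + a)) (twist s 0 (b + c)) *
        (crossing s b a c * ppow (crossing s b c a * crossing s b a c) F.half) *
        ev F.f (twist s 0 (b + a)) (twist s b (a + c)) *
        (crossing s 0 a b * ppow (crossing s 0 b a * crossing s 0 a b) F.half) =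
      ppow (crossing s 0 a (b + c) * crossing s 0 (b + c) a) F.half * crossing s 0 a (b + c) *
        ev F.f (twist s 0 (a + b)) (twist s a (b + c)) := by
  apply eq_of_forall_finite
  intro Q _ φ
  have hm : ∀ o k, φ (twist s o k) = twist (fun i => φ (s i)) o k :=
    fun o k => map_twist (φ : P →* Q) s o k
  have hs' : ∀ o b, φ (strandCrossing s o b) = strandCrossing (fun i => φ (s i)) o b := by
    intro o b
    induction b with
    | zero => exact map_one φ
    | succ b ih => rw [strandCrossing, map_mul, ih, strandCrossing]
  have hc : ∀ o a b, φ (crossing s o a b) = crossing (fun i => φ (s i)) o a b := by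
    intro o a b
    induction a with
    | zero => exact map_one φ
    | succ a ih => rw [crossing, map_mul, ih, crossing, hs']
  simp only [map_mul, map_ev, map_ppow, hm, hc]
  exact F.hexagon_packets_finite (hs.map (φ : P →* Q)) h

/-! ## The Drinfeld automorphism -/

/-- Identifies `η` with the loop of one strand around all previous ones. -/
theorem eta_succ (s : ℕ → P) (k : ℕ) : eta s (k + 1) = crossing s 0 1 k * crossing s 0 k 1 := by
  rw [crossing_one_left, crossing_one_right]
  induction k with
  | zero => simp [eta, strandCrossing, ascending]
  | succ k ih =>
    rw [eta, ih, strandCrossing, ascending_succ, Nat.zero_add]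
    simp only [mul_assoc]

variable {N : ℕ} {s : ℕ → P}

theorem IsBraidSeq.twist_mul_eta (hs : IsBraidSeq N s) {k : ℕ} (hk : k + 1 ≤ N) :
    twist s 0 (k + 1) = twist s 0 k * eta s (k + 1) := by
  rw [hs.twist_succ (by omega), eta_succ]

theorem IsBraidSeq.twist_commute_eta (hs : IsBraidSeq N s) {k : ℕ} (hk : k + 1 ≤ N) :
    Commute (twist s 0 k) (eta s (k + 1)) := by
  have h := hs.twist_commute_twist (o := 0) (k := k + 1) (o' := 0) (k' := k) (by omega) (by omega)
  rw [hs.twist_mul_eta hk] at h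
  have := h.symm.eq
  rw [mul_assoc] at this
  exact mul_left_cancel this

namespace GT

variable (F : GT)

/-- The full twist of the first `i` strands is `η_i` times that of the first `i - 1`, and the latter
commutes with both arguments. Hence the Drinfeld formulas can be written with full twists, as the
pentagon requires. -/
theorem ev_eta (hs : IsBraidSeq N s) {i : ℕ} (h1 : 1 ≤ i) (hi : i < N) :
    ev F.f (eta s i) (s i ^ 2) = ev F.f (twist s 0 i) (s i ^ 2) := by
  obtain ⟨k, rfl⟩ : ∃ k, i = k + 1 := ⟨i - 1, by omega⟩
  have hc := hs.twist_commute_eta (k := k) (by omega)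
  have hc' : Commute (twist s 0 k) (s (k + 1) ^ 2) :=
    (hs.twist_commute (by omega) (by omega) (by omega)).pow_right 2
  have := F.ev_mul_central (a := eta s (k + 1)) (b := s (k + 1) ^ 2) (c := twist s 0 k) (d := 1)
    hc.symm (Commute.one_right _) hc'.symm (Commute.one_right _) (Commute.one_right _)
  rw [mul_one, ← hc.eq, ← hs.twist_mul_eta (by omega)] at this
  exact this.symm

/-- The value of the Drinfeld action at the generator `s i`. -/
def drinfeld (s : ℕ → P) (i : ℕ) : P :=
  (ev F.f (twist s 0 i) (s i ^ 2))⁻¹ * ppow (s i) F.lam * ev F.f (twist s 0 i) (s i ^ 2)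

theorem drinfeld_one (s : ℕ → P) : F.drinfeld s 1 = ppow (s 1) F.lam := by
  rw [drinfeld, twist_one, F.ev_one (Commute.one_left _)]; simp

theorem isDrinfeldAction_iff (hs : IsBraidSeq N s) (hN : 2 ≤ N) (φ : P ≃ₜ* P) :
    IsDrinfeldAction F N s φ ↔ ∀ i, 1 ≤ i → i < N → φ (s i) = F.drinfeld s i := by
  have e : ∀ i, 1 ≤ i → i < N → ev F.f (s i ^ 2) (eta s i) * ppow (s i) F.lam *
      ev F.f (eta s i) (s i ^ 2) = F.drinfeld s i := by
    intro i h1 h2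
    rw [drinfeld, ← F.ev_eta hs h1 h2, F.inv_ev]
  constructor
  · rintro ⟨h1, h2⟩ i hi hiN
    rcases Nat.lt_or_ge 1 i with h | h
    · rw [h2 i h (by omega), e i hi hiN]
    · obtain rfl : i = 1 := by omega
      rw [h1, drinfeld_one]
  · intro h
    refine ⟨by rw [h 1 le_rfl hN, drinfeld_one], fun i hi hiN => ?_⟩
    rw [e i (by omega) (by omega), h i (by omega) (by omega)]

theorem commute_drinfeld {g : P} {i : ℕ} (h1 : Commute g (twist s 0 i)) (h2 : Commute g (s i)) :
    Commute g (F.drinfeld s i) := by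
  have := commute_ev F.f h1 (h2.pow_right 2)
  exact (this.inv_right.mul_right (commute_ppow _ h2)).mul_right this

/-- The value at `j` is a word in `s j` and the twist of the first `j` strands, and both commute
with `s 1, …, s i`, of which the value at `i` is a word. -/
theorem drinfeld_comm (hs : IsBraidSeq N s) {i j : ℕ} (hi : 1 ≤ i) (hij : i + 2 ≤ j) (hj : j < N) :
    Commute (F.drinfeld s i) (F.drinfeld s j) := by
  have h : ∀ l, 1 ≤ l → l ≤ i → Commute (F.drinfeld s j) (s l) := fun l h1 h2 =>
    (F.commute_drinfeld (hs.twist_commute (by omega) (by omega) (by omega)).symm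
      (hs.comm l j (by omega))).symm
  exact (F.commute_drinfeld (commute_twist fun l h1 h2 => h l h1 (by omega)) (h i hi le_rfl)).symm

/-- The pentagon for `k, 1, 1, 1` reads `α * g₂ = p * β * g₁`. Since `β` commutes with the first
generator and `α` with the second, conjugation by the single element `β * g₁` brings both values to
those in `second_braid`. -/
theorem drinfeld_braid (hs : IsBraidSeq N s) {i : ℕ} (hi : 1 ≤ i) (hN : i + 1 < N) :
    F.drinfeld s i * F.drinfeld s (i + 1) * F.drinfeld s i =
      F.drinfeld s (i + 1) * F.drinfeld s i * F.drinfeld s (i + 1) := by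
  obtain ⟨k, rfl⟩ : ∃ k, i = k + 1 := ⟨i - 1, by omega⟩
  have hp := F.pentagon hs (k := k) (a := 1) (b := 1) (c := 1) (by omega)
  simp only [Nat.reduceAdd, twist_two, Nat.add_assoc] at hp
  have hβ : Commute (ppow (s (k + 1)) F.lam) (ev F.f (twist s 0 (k + 2)) (twist s k 3)) :=
    (commute_ppow _ (commute_ev _ (hs.twist_commute (by omega) (by omega) (by omega)).symm
      (hs.twist_commute (by omega) (by omega) (by omega)).symm).symm).symm
  have hα : Commute (ppow (s (k + 2)) F.lam) (ev F.f (twist s 0 (k + 1)) (twist s k 3)) :=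
    (commute_ppow _ (commute_ev _ (hs.twist_commute (by omega) (by omega) (by omega)).symm
      (hs.twist_commute (by omega) (by omega) (by omega)).symm).symm).symm
  have hb := F.second_braid (hs.braid (k + 1) (by omega) (by omega))
  rw [second, ← F.inv_ev] at hb
  unfold drinfeld
  simp only [Nat.add_assoc, Nat.reduceAdd] at hb ⊢
  generalize ev F.f (twist s 0 (k + 1)) (s (k + 1) ^ 2) = g₁ at *
  generalize ev F.f (twist s 0 (k + 2)) (s (k + 2) ^ 2) = g₂ at *
  generalize ev F.f (twist s 0 (k + 1)) (twist s k 3) = α at *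
  generalize ev F.f (twist s 0 (k + 2)) (twist s k 3) = β at *
  generalize ev F.f (s (k + 1) ^ 2) (s (k + 2) ^ 2) = p at *
  generalize ppow (s (k + 1)) F.lam = A at *
  generalize ppow (s (k + 2)) F.lam = C at *
  have e1 : g₁⁻¹ * A * g₁ = (β * g₁)⁻¹ * A * (β * g₁) := by
    rw [mul_inv_rev, ← mul_assoc, mul_assoc _ β⁻¹ A, ← hβ.inv_right.eq]
    simp [mul_assoc]
  have e2 : g₂⁻¹ * C * g₂ = (β * g₁)⁻¹ * (p⁻¹ * C * p) * (β * g₁) := by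
    have hg : g₂ = α⁻¹ * (p * (β * g₁)) := by rw [eq_inv_mul_iff_mul_eq, hp, mul_assoc]
    rw [hg, mul_inv_rev, inv_inv]
    calc _ = (p * (β * g₁))⁻¹ * (α * C) * α⁻¹ * (p * (β * g₁)) := by simp only [mul_assoc]
      _ = _ := by rw [← hα.eq]; simp [mul_assoc]
  rw [e1, e2]
  generalize β * g₁ = h
  calc _ = h⁻¹ * (A * (p⁻¹ * C * p) * A) * h := by simp [mul_assoc]
    _ = _ := by rw [hb]; simp [mul_assoc]

end GT

/-! ### Bijectivity -/

/-- A continuous bijective homomorphism from a profinite group is an isomorphism. -/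
def equivOfBijective {M : Type*} [Group M] [TopologicalSpace M] [T2Space M] (φ : P →ₜ* M)
    (h : Function.Bijective φ) : P ≃ₜ* M :=
  { MulEquiv.ofBijective φ h with
    continuous_toFun := map_continuous φ
    continuous_invFun := (Continuous.homeoOfEquivCompactToT2
      (f := (MulEquiv.ofBijective φ h).toEquiv) (map_continuous φ)).continuous_invFun }

theorem isClosed_range (φ : P →ₜ* Q) : IsClosed (((φ : P →* Q).range : Subgroup Q) : Set Q) := by
  have := (isCompact_range (map_continuous φ)).isClosed
  exact this

/-- Profinite braid groups are Hopfian. -/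
theorem injective_of_surjective {n : ℕ} (φ : BHat n →ₜ* BHat n) (h : Function.Surjective φ) :
    Function.Injective φ := by
  rw [injective_iff_map_eq_one]
  intro x hx
  apply eq_of_forall_finite
  intro Q _ ψ
  -- There are finitely many homomorphisms to `Q`, and precomposition with the surjection `φ` is
  -- injective on them. So it is bijective, and every `ψ` factors through `φ` and kills its kernel.
  have hfin : Finite (BHat n →ₜ* Q) := by
    apply Finite.of_injective (fun (χ : BHat n →ₜ* Q) (i : Fin n) => χ (sigma n i))
    intro χ χ' hχ
    exact braid_hom_ext fun i h1 h2 => congrFun hχ ⟨i, h2⟩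
  have hinj : Function.Injective fun χ : BHat n →ₜ* Q => χ.comp φ := by
    intro χ χ' hχ
    ext y
    obtain ⟨z, rfl⟩ := h y
    exact DFunLike.congr_fun hχ z
  obtain ⟨χ, rfl⟩ := Finite.surjective_of_injective hinj ψ
  change χ (φ x) = _
  rw [hx, map_one, map_one]

theorem GT.exists_drinfeld (F : GT) {n : ℕ} (hn : 2 ≤ n) :
    ∃ D : BHat n ≃ₜ* BHat n, IsDrinfeldAction F n (sigma n) D := by
  have hs := isBraidSeq_sigma n
  obtain ⟨φ, hφ⟩ := exists_braid_hom (n := n) (s := F.drinfeld (sigma n))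
    (fun i j h1 h2 h3 => F.drinfeld_comm hs h1 h2 h3) (fun i h1 h2 => F.drinfeld_braid hs h1 h2)
  have hcl := isClosed_range φ
  have hmem : ∀ i, 1 ≤ i → i < n → sigma n i ∈ (φ : BHat n →* BHat n).range := by
    intro i
    induction i using Nat.strong_induction_on with
    | _ i ih =>
    intro h1 h2
    have hT : twist (sigma n) 0 i ∈ (φ : BHat n →* BHat n).range := by
      refine Subgroup.pow_mem _ (Subgroup.list_prod_mem _ fun z hz => ?_) _
      obtain ⟨j, hj, rfl⟩ := List.mem_map.1 hz
      rw [List.mem_range] at hj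
      exact ih _ (by omega) (by omega) (by omega)
    have hD : F.drinfeld (sigma n) i ∈ (φ : BHat n →* BHat n).range := ⟨sigma n i, hφ i h1 h2⟩
    -- The range contains the twist `T` by induction, and `f⁻¹ (σ_i²)^λ f` as the square of the
    -- value at `σ_i`, where `f` stands for `f(T, σ_i²)`. The substitution attached to `F` is
    -- surjective, so every word in `T` and `σ_i²` is a word in `T^λ` and this element. In
    -- particular `f` itself lies in the range, hence `σ_i^λ`, hence `σ_i`.
    have hev : ∀ w : F2Hat, ev w (twist (sigma n) 0 i) (sigma n i ^ 2) ∈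
        (φ : BHat n →* BHat n).range := by
      intro w
      obtain ⟨w, rfl⟩ := F.bijective.2 w
      change ev (ev w _ _) _ _ ∈ _
      rw [ev_ev]
      refine ev_mem hcl _ ?_ ?_
      · rw [show ev (ppow genX F.lam) (twist (sigma n) 0 i) (sigma n i ^ 2) = _ from
          map_ppow (subst _ _) _ _, show subst _ _ genX = _ from ev_genX _ _]
        exact ppow_mem hcl _ hT
      · rw [ev_mul, ev_mul, ev_inv,
          show ev (ppow genY F.lam) (twist (sigma n) 0 i) (sigma n i ^ 2) = _ from
          map_ppow (subst _ _) _ _, show subst _ _ genY = _ from ev_genY _ _, sq,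
          ppow_mul_of_commute (Commute.refl _)]
        have := Subgroup.mul_mem _ hD hD
        convert this using 1
        simp [GT.drinfeld, mul_assoc, sq]
    have hf := hev F.f
    apply F.mem_of_ppow_lam_mem hcl
    have := Subgroup.mul_mem _ (Subgroup.mul_mem _ hf hD) (Subgroup.inv_mem _ hf)
    convert this using 1
    simp [GT.drinfeld, mul_assoc]
  have hsurj : Function.Surjective φ := fun x => braid_induction hcl hmem x
  refine ⟨equivOfBijective φ ⟨injective_of_surjective φ hsurj, hsurj⟩, ?_⟩
  rw [F.isDrinfeldAction_iff hs hn]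
  exact hφ

theorem GT.drinfeld_unique (F : GT) {n : ℕ} (hn : 2 ≤ n) {D D' : BHat n ≃ₜ* BHat n}
    (h : IsDrinfeldAction F n (sigma n) D) (h' : IsDrinfeldAction F n (sigma n) D') : D = D' := by
  rw [F.isDrinfeldAction_iff (isBraidSeq_sigma n) hn] at h h'
  have : toHom D = toHom D' := braid_hom_ext fun i h1 h2 => by
    rw [toHom_apply, toHom_apply, h i h1 h2, h' i h1 h2]
  ext x
  exact DFunLike.congr_fun this x

/-! ## Coherence for bracketings -/

theorem BTree.size_pos (t : BTree) : 0 < t.size := by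
  induction t with
  | pt => exact Nat.one_pos
  | pair L R hL hR => exact Nat.add_pos_left hL _

theorem AMove.size_eq {o : ℕ} {t t' : BTree} {b b' : ℕ × ℕ} (h : AMove o t t' b b') :
    t'.size = t.size := by
  induction h with
  | assoc o X₁ X₂ X₃ => simp only [BTree.size]; omega
  | symm _ ih => exact ih.symm
  | left R _ ih => simp only [BTree.size]; omega
  | right L _ ih => simp only [BTree.size]; omega

theorem AMove.packet_le {o : ℕ} {t t' : BTree} {b b' : ℕ × ℕ} (h : AMove o t t' b b') :
    (o ≤ b.1 ∧ b.1 + b.2 ≤ o + t.size) ∧ (o ≤ b'.1 ∧ b'.1 + b'.2 ≤ o + t.size) := by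
  induction h with
  | assoc o X₁ X₂ X₃ => simp only [BTree.size]; omega
  | symm h ih => rw [h.size_eq]; exact ih.symm
  | left R _ ih => simp only [BTree.size]; omega
  | right L _ ih => simp only [BTree.size]; omega

namespace GT

variable (F : GT) (n : ℕ)

/-- The product of the associators along a sequence of A-moves which transforms the bracketing
`(X, t)` into the one obtained by adding the points of `t` to the packet `X` of the first `k` points
one after the other. -/
def normalizer : ℕ → BTree → BHat n
  | _, .pt => 1
  | k, .pair L R => normalizer (k + L.size) R * normalizer k L *
      ev F.f (twist (sigma n) k (L.size + R.size)) (twist (sigma n) 0 (k + L.size))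

variable {n}

theorem commute_normalizer {g : BHat n} {k : ℕ} {t : BTree}
    (h1 : ∀ j, k ≤ j → j ≤ k + t.size → Commute g (twist (sigma n) 0 j))
    (h2 : ∀ o l, k ≤ o → o + l ≤ k + t.size → Commute g (twist (sigma n) o l)) :
    Commute g (F.normalizer n k t) := by
  induction t generalizing k with
  | pt => exact Commute.one_right g
  | pair L R hL hR =>
    simp only [BTree.size] at h1 h2
    refine ((hR (fun j _ _ => h1 j (by omega) (by omega)) fun o l _ _ => h2 o l (by omega)
      (by omega)).mul_right (hL (fun j _ _ => h1 j (by omega) (by omega)) fun o l _ _ => h2 o l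
      (by omega) (by omega))).mul_right ?_
    exact commute_ev _ (h2 _ _ (by omega) (by omega)) (h1 _ (by omega) (by omega))

/-- All the associators involved have nested packets starting at the first point as arguments; their
twists commute, so `f` is trivial on them. -/
theorem normalizer_leftComb (k : ℕ) (hk : k ≤ n) : F.normalizer n 0 (leftComb k) = 1 := by
  induction k with
  | zero => rfl
  | succ k ih =>
    rcases k with _ | k
    · rfl
    · rw [leftComb, normalizer, normalizer, ih (by omega), one_mul, one_mul, size_leftComb _ (by omega)]
      exact F.ev_one ((isBraidSeq_sigma n).twist_commute_twist (by simp only [BTree.size]; omega)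
        (by simp only [BTree.size]; omega))

/-- Along an A-move, the normalizers differ by the associator of the move. -/
theorem normalizer_eq {k : ℕ} {t t' : BTree} {b b' : ℕ × ℕ} (h : AMove k t t' b b')
    (hn : k + t.size ≤ n) :
    F.normalizer n k t = F.normalizer n k t' * ev F.f (fullTwist n b) (fullTwist n b') := by
  have hs := isBraidSeq_sigma n
  simp only [fullTwist_eq]
  induction h with
  | assoc o X₁ X₂ X₃ =>
    simp only [BTree.size] at hn
    simp only [normalizer, BTree.size]
    -- The four packets are the `o` points to the left of the tree and the three subtrees. The two
    -- normalizers arrange the same contributions of the subtrees around different associators, and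
    -- `hc` moves the one that stands on the wrong side of the contribution of `X₁`.
    have hp := F.pentagon hs (k := o) (a := X₁.size) (b := X₂.size) (c := X₃.size) (by omega)
    have hc : Commute (ev F.f (twist (sigma n) (o + X₁.size) (X₂.size + X₃.size))
        (twist (sigma n) 0 (o + X₁.size + X₂.size))) (F.normalizer n o X₁) := by
      refine F.commute_normalizer (fun j _ _ => ?_) fun o' l _ _ => ?_
      · exact (commute_ev _ (hs.twist_commute_twist (by omega) (by omega))
          (hs.twist_commute_twist (by omega) (by omega)).symm).symm
      · exact (commute_ev _ (hs.twist_commute_twist (by omega) (by omega))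
          (hs.twist_commute_twist (by omega) (by omega)).symm).symm
    simp only [← Nat.add_assoc] at *
    have hi := congrArg (fun g => g⁻¹) hp
    simp only [mul_inv_rev, F.inv_ev] at hi
    have hone := F.ev_symm_mul (twist (sigma n) (o + X₁.size) (X₂.size + X₃.size))
      (twist (sigma n) o (X₁.size + X₂.size))
    calc _ = F.normalizer n (o + X₁.size + X₂.size) X₃ * F.normalizer n (o + X₁.size) X₂ *
          F.normalizer n o X₁ *
          (ev F.f (twist (sigma n) o (X₁.size + X₂.size)) (twist (sigma n) 0 (o + X₁.size)) *
          (ev F.f (twist (sigma n) o (X₁.size + X₂.size + X₃.size))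
            (twist (sigma n) 0 (o + X₁.size + X₂.size)) *
            (ev F.f (twist (sigma n) (o + X₁.size) (X₂.size + X₃.size))
              (twist (sigma n) o (X₁.size + X₂.size)) *
            ev F.f (twist (sigma n) o (X₁.size + X₂.size))
              (twist (sigma n) (o + X₁.size) (X₂.size + X₃.size))))) := by
            rw [hone, mul_one]; simp only [mul_assoc]
      _ = F.normalizer n (o + X₁.size + X₂.size) X₃ * F.normalizer n (o + X₁.size) X₂ *
          (F.normalizer n o X₁ *
          ev F.f (twist (sigma n) (o + X₁.size) (X₂.size + X₃.size))
            (twist (sigma n) 0 (o + X₁.size + X₂.size))) *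
            ev F.f (twist (sigma n) o (X₁.size + X₂.size + X₃.size))
              (twist (sigma n) 0 (o + X₁.size)) *
            ev F.f (twist (sigma n) o (X₁.size + X₂.size))
              (twist (sigma n) (o + X₁.size) (X₂.size + X₃.size)) := by
          have hi' := congrArg (fun g => g * ev F.f (twist (sigma n) o (X₁.size + X₂.size))
              (twist (sigma n) (o + X₁.size) (X₂.size + X₃.size))) hi
          simp only [mul_assoc] at hi' ⊢
          rw [← hi']
      _ = _ := by rw [← hc.eq]; simp only [mul_assoc]
  | symm h ih =>
    rw [← h.size_eq] at ih
    rw [ih hn, mul_assoc, F.ev_symm_mul, mul_one]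
  | @left o L L' b b' R h ih =>
    simp only [BTree.size] at hn
    have hb := h.packet_le
    rw [normalizer, normalizer, ih (by omega), h.size_eq]
    have hc : Commute (ev F.f (twist (sigma n) b.1 b.2) (twist (sigma n) b'.1 b'.2))
        (ev F.f (twist (sigma n) o (L.size + R.size)) (twist (sigma n) 0 (o + L.size))) := by
      refine commute_ev_ev _ _ ?_ ?_ ?_ ?_ <;>
        exact (hs.twist_commute_twist (by omega) (by omega)).symm
    simp only [mul_assoc]
    rw [hc.eq]
  | @right o R R' b b' L h ih =>
    simp only [BTree.size] at hn
    have hb := h.packet_le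
    rw [normalizer, normalizer, ih (by omega), h.size_eq]
    have hc : Commute (ev F.f (twist (sigma n) b.1 b.2) (twist (sigma n) b'.1 b'.2))
        (ev F.f (twist (sigma n) o (L.size + R.size)) (twist (sigma n) 0 (o + L.size))) := by
      refine commute_ev_ev _ _ ?_ ?_ ?_ ?_ <;>
        exact (hs.twist_commute_twist (by omega) (by omega)).symm
    have hc' : Commute (ev F.f (twist (sigma n) b.1 b.2) (twist (sigma n) b'.1 b'.2))
        (F.normalizer n o L) := by
      refine F.commute_normalizer (fun j _ _ => ?_) fun o' l _ _ => ?_ <;>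
        exact (commute_ev _ (hs.twist_commute_twist (by omega) (by omega)).symm
          (hs.twist_commute_twist (by omega) (by omega)).symm).symm
    simp only [mul_assoc]
    rw [← hc.eq, hc'.left_comm]

end GT

/-! ### Connectedness of the graph of bracketings -/

/-- Two bracketings are related by a sequence of A-moves. -/
def Linked (o : ℕ) : BTree → BTree → Prop :=
  Relation.ReflTransGen fun t t' => ∃ b b', AMove o t t' b b'

theorem Linked.pair_left {o : ℕ} {L L' : BTree} (h : Linked o L L') (R : BTree) :
    Linked o (.pair L R) (.pair L' R) := by
  induction h with
  | refl => exact .refl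
  | tail _ h ih =>
    obtain ⟨b, b', h⟩ := h
    exact ih.tail ⟨b, b', .left R h⟩

/-- For `R = (R₁, R₂)` the comb yields `R₂`, then `R₁` from what is left, and one associativity move
joins them. -/
theorem linked_leftComb_pair (o k : ℕ) (R : BTree) :
    Linked o (leftComb (k + 1 + R.size)) (.pair (leftComb (k + 1)) R) := by
  induction R generalizing k with
  | pt => exact Relation.ReflTransGen.refl
  | pair R₁ R₂ h₁ h₂ =>
    have h3 := h₂ (k + R₁.size)
    have e : k + R₁.size + 1 = k + 1 + R₁.size := by omega
    rw [e] at h3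
    have h4 := h3.trans ((h₁ k).pair_left R₂)
    rw [BTree.size, ← Nat.add_assoc]
    exact h4.tail ⟨_, _, .assoc o _ R₁ R₂⟩

theorem linked_leftComb (o : ℕ) (t : BTree) : Linked o (leftComb t.size) t := by
  induction t with
  | pt => exact Relation.ReflTransGen.refl
  | pair L R hL _ =>
    obtain ⟨k, hk⟩ : ∃ k, L.size = k + 1 := ⟨L.size - 1, by have := L.size_pos; omega⟩
    rw [hk] at hL
    rw [BTree.size, hk]
    exact (linked_leftComb_pair o k R).trans (hL.pair_left R)

namespace GT

variable (F : GT) {n : ℕ} [NeZero n]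

/-- By `normalizer_eq` the associators telescope along any chain of A-moves starting from the
standard bracketing, and such a chain reaches every `B`. -/
theorem family_apply {A : MaxBracketing n → (BHat n ≃ₜ* BHat n)} (hA : IsBracketingFamily F A)
    (B : MaxBracketing n) (x : BHat n) :
    A B x = (F.normalizer n 0 B.1)⁻¹ * A (stdBracketing n) x * F.normalizer n 0 B.1 := by
  have key : ∀ t, Linked 0 (leftComb n) t → ∃ ht : t.size = n, A ⟨t, ht⟩ x =
      (F.normalizer n 0 t)⁻¹ * A (stdBracketing n) x * F.normalizer n 0 t := by
    intro t h
    induction h with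
    | refl =>
      refine ⟨(stdBracketing n).2, ?_⟩
      rw [F.normalizer_leftComb n le_rfl, inv_one, one_mul, mul_one]
      rfl
    | @tail t t' _ h ih =>
      obtain ⟨b, b', h⟩ := h
      obtain ⟨ht, ih⟩ := ih
      refine ⟨h.size_eq.trans ht, ?_⟩
      rw [hA.amove ⟨t, ht⟩ ⟨t', _⟩ b b' h x, ih, F.normalizer_eq h (by omega)]
      simp [mul_assoc]
  obtain ⟨_, h⟩ := key B.1 (by
    have := linked_leftComb 0 B.1
    rwa [B.2] at this)
  exact h

theorem existsUnique_family (hn : 2 ≤ n) :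
    ∃! A : MaxBracketing n → (BHat n ≃ₜ* BHat n), IsBracketingFamily F A := by
  obtain ⟨D, hD⟩ := F.exists_drinfeld hn
  refine ⟨fun B => D.trans (inn (F.normalizer n 0 B.1)⁻¹), ⟨?_, ?_⟩, fun A hA => ?_⟩
  · have : D.trans (inn (F.normalizer n 0 (stdBracketing n).1)⁻¹) = D := by
      ext x
      change inn _ (D x) = D x
      rw [inn_apply, stdBracketing, F.normalizer_leftComb n le_rfl]
      simp
    rw [this]
    exact hD
  · intro B B' b b' h x
    change inn _ (D x) = _ * inn _ (D x) * _
    rw [inn_apply, inn_apply, F.normalizer_eq h (by have := B.2; omega)]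
    simp [mul_assoc]
  · funext B
    ext x
    rw [F.family_apply hA, F.drinfeld_unique hn hA.standard hD]
    change _ = inn _ (D x)
    rw [inn_apply, inv_inv]

end GT

/-! ### Brackets around two points -/

/-- The bracketing `t` of the points `k + 1, k + 2, …` has brackets around `j` and `j + 1`. -/
def HasNode : ℕ → BTree → ℕ → Prop
  | _, .pt, _ => False
  | k, .pair L R, j => (L = .pt ∧ R = .pt ∧ j = k + 1) ∨ HasNode k L j ∨ HasNode (k + L.size) R j

namespace GT

variable (F : GT) {n : ℕ}

/-- The node around `j` and `j + 1` contributes the factor `f(σ_j², T)` with `T` the twist of the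
first `j` points, which conjugates `σ_j^λ` to the Drinfeld value. Factors to the right of it commute
with `σ_j`, and factors to the left commute with the Drinfeld value. -/
theorem normalizer_semiconj {k j : ℕ} {t : BTree} (h : HasNode k t j) (hn : k + t.size ≤ n) :
    k < j ∧ j < k + t.size ∧
      SemiconjBy (F.normalizer n k t) (ppow (sigma n j) F.lam) (F.drinfeld (sigma n) j) := by
  have hs := isBraidSeq_sigma n
  induction t generalizing k with
  | pt => exact h.elim
  | pair L R hL hR =>
    simp only [BTree.size] at hn ⊢
    have hLp := L.size_pos
    have hRp := R.size_pos
    rcases h with ⟨rfl, rfl, rfl⟩ | h | h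
    · refine ⟨by omega, by simp only [BTree.size]; omega, ?_⟩
      simp only [normalizer, BTree.size, one_mul, Nat.reduceAdd, twist_two, drinfeld]
      rw [F.inv_ev, ← F.inv_ev (sigma n (k + 1) ^ 2)]
      change _ * _ = _ * _
      simp
    · obtain ⟨h1, h2, ih⟩ := hL h (by omega)
      refine ⟨h1, by omega, SemiconjBy.mul_left (SemiconjBy.mul_left ?_ ih) ?_⟩
      · have hl : ∀ l, 1 ≤ l → l ≤ j → ∀ o m, o + m ≤ n → (o = 0 ∧ j < m ∨ j < o) →
            Commute (twist (sigma n) o m) (sigma n l) := fun l _ _ o m _ _ =>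
          hs.twist_commute (by omega) (by omega) (by omega)
        have hd : ∀ o m, o + m ≤ n → (o = 0 ∧ j < m ∨ j < o) →
            Commute (F.drinfeld (sigma n) j) (twist (sigma n) o m) := fun o m h3 h4 =>
          (F.commute_drinfeld (commute_twist fun i _ _ => hl i (by omega) (by omega) o m h3 h4)
            (hl j (by omega) le_rfl o m h3 h4)).symm
        exact (F.commute_normalizer (fun i _ _ => hd _ _ (by omega) (by omega))
          fun o l _ _ => hd _ _ (by omega) (by omega)).symm
      · exact commute_ppow _ (commute_ev _ (hs.twist_commute (by omega) (by omega) (by omega)).symm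
          (hs.twist_commute (by omega) (by omega) (by omega)).symm).symm
    · obtain ⟨h1, h2, ih⟩ := hR h (by omega)
      refine ⟨by omega, by omega, SemiconjBy.mul_left (y := ppow (sigma n j) F.lam)
        (SemiconjBy.mul_left (y := ppow (sigma n j) F.lam) ih ?_) ?_⟩
      · exact commute_ppow _ (F.commute_normalizer
          (fun i _ _ => (hs.twist_commute (by omega) (by omega) (by omega)).symm)
          fun o l _ _ => (hs.twist_commute (by omega) (by omega) (by omega)).symm).symm
      · exact commute_ppow _ (commute_ev _ (hs.twist_commute (by omega) (by omega) (by omega)).symm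
          (hs.twist_commute (by omega) (by omega) (by omega)).symm).symm

/-- If there are brackets around the points `j` and `j + 1`, the action on `σ_j` is `σ_j ↦ σ_j^λ`. -/
theorem family_sigma [NeZero n] (hn : 2 ≤ n) {A : MaxBracketing n → (BHat n ≃ₜ* BHat n)}
    (hA : IsBracketingFamily F A) (B : MaxBracketing n) {j : ℕ} (h : HasNode 0 B.1 j) :
    A B (sigma n j) = ppow (sigma n j) F.lam := by
  obtain ⟨h1, h2, h3⟩ := F.normalizer_semiconj h (n := n) (by have := B.2; omega)
  have hstd := (F.isDrinfeldAction_iff (isBraidSeq_sigma n) hn _).1 hA.standard j (by omega)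
    (by have := B.2; omega)
  rw [F.family_apply hA, hstd, mul_assoc, ← h3.eq, inv_mul_cancel_left]

end GT

/-! ## The action on flat crossings of packets of two points -/

namespace GT

variable (F : GT)

/-- The pentagon gives a second form of the conjugating element `h`, in which `q` commutes with `s
2`. Using the second form in the left `φ₂` and the first in the right one, each half becomes a
hexagon on three strands (`m32`, `m12`), and their product is the hexagon for packets of `2`, `1`
and `1` strands. -/
theorem flat_crossing {s : ℕ → P} (hs : IsBraidSeq 4 s) {φ₁ φ₂ φ₃ h : P}
    (h₁ : φ₁ = ppow (s 1) F.lam) (h₃ : φ₃ = ppow (s 3) F.lam)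
    (h₂ : φ₂ = h⁻¹ * ppow (s 2) F.lam * h)
    (hh : h = ev F.f (s 1 ^ 2) (s 2 ^ 2) * ev F.f (s 3 ^ 2) (twist s 0 3)) :
    φ₂ * φ₁ * φ₃ * φ₂ = ppow (s 2 * s 1 * s 3 * s 2) F.lam := by
  have hp := F.pentagon hs (k := 1) (a := 1) (b := 1) (c := 1) (by omega)
  simp only [Nat.reduceAdd, twist_two] at hp
  have hx := F.hexagon_packets hs (a := 2) (b := 1) (c := 1) (by omega)
  simp only [crossing, strandCrossing, Nat.reduceAdd, twist_two, one_mul, mul_one] at hx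
  have b12 := hs.braid 1 le_rfl (by omega)
  have b32 : s 3 * s 2 * s 3 = s 2 * s 3 * s 2 := (hs.braid 2 (by omega) (by omega)).symm
  have m12 := F.mul_second b12
  have m32 := F.second_mul b32
  rw [second] at m12 m32
  have c13 : Commute (s 1) (s 3) := hs.comm 1 3 le_rfl
  have t3 : ∀ i, i ≠ 0 → i ≠ 3 → Commute (s i) (twist s 0 3) := fun i h1 h2 =>
    (hs.twist_commute (by omega) (by omega) (by omega)).symm
  have t13 : ∀ i, i ≠ 1 → i ≠ 4 → Commute (s i) (twist s 1 3) := fun i h1 h2 =>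
    (hs.twist_commute (by omega) (by omega) (by omega)).symm
  have hw : Commute (ppow (s 1) F.lam) (ev F.f (s 3 ^ 2) (twist s 0 3)) :=
    (commute_ppow _ (commute_ev _ (c13.pow_right 2) (t3 1 (by omega) (by omega))).symm).symm
  have hw' : Commute (ppow (s 3) F.lam) (ev F.f (s 1 ^ 2) (twist s 1 3)) :=
    (commute_ppow _ (commute_ev _ (c13.symm.pow_right 2) (t13 3 (by omega) (by omega))).symm).symm
  have hq : Commute (ppow (s 2) F.lam) (ev F.f (twist s 0 3) (twist s 1 3)) :=
    (commute_ppow _ (commute_ev _ (t3 2 (by omega) (by omega))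
      (t13 2 (by omega) (by omega))).symm).symm
  have c13' : Commute (ppow (s 1) F.lam) (ppow (s 3) F.lam) :=
    commute_ppow _ (commute_ppow _ c13.symm).symm
  have e1 : s 2 * s 3 * ppow (s 3 * s 2 * (s 2 * s 3)) F.half =
      ppow (s 2 * s 3 ^ 2 * s 2) F.half * (s 2 * s 3) := by
    refine (semiconjBy_ppow F.half ?_).eq
    change _ * _ = _ * _
    simp only [sq, mul_assoc]
  have e2 : s 2 * s 1 ^ 2 * s 2 = s 2 * s 1 * (s 1 * s 2) := by simp only [sq, mul_assoc]
  have e3 : s 2 * s 1 * (s 3 * s 2) = s 2 * s 1 * s 3 * s 2 := by simp only [mul_assoc]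
  rw [e1, e3, ← sq, ← F.ppow_lam', ← F.inv_ev (s 1 ^ 2), ← F.inv_ev (s 3 ^ 2) (twist s 0 3)] at hx
  rw [← F.inv_ev (s 1 ^ 2) (s 2 ^ 2), e2] at m12
  rw [← F.inv_ev (s 2 ^ 2) (s 3 ^ 2)] at m32
  rw [← F.inv_ev (s 3 ^ 2) (twist s 0 3)] at hp
  rw [h₁, h₂, h₃, hh]
  clear h₁ h₂ h₃ hh e1 e2 e3 t3 t13 b12 b32
  generalize ev F.f (s 3 ^ 2) (twist s 0 3) = w at *
  generalize ev F.f (s 1 ^ 2) (twist s 1 3) = w' at *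
  generalize ev F.f (twist s 0 3) (twist s 1 3) = q at *
  generalize ev F.f (s 1 ^ 2) (s 2 ^ 2) = p at *
  generalize ev F.f (s 2 ^ 2) (s 3 ^ 2) = r at *
  generalize ppow (s 1) F.lam = A at *
  generalize ppow (s 2) F.lam = B at *
  generalize ppow (s 3) F.lam = C at *
  generalize ppow (s 2 * s 3 ^ 2 * s 2) F.half = E' at *
  generalize ppow (s 2 * s 1 * (s 1 * s 2)) F.half = E at *
  generalize ppow (s 2 * s 1 * s 3 * s 2) F.lam = M at *
  have k1 : p * w = q⁻¹ * (r⁻¹ * w') := by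
    rw [eq_inv_mul_iff_mul_eq, eq_inv_mul_iff_mul_eq, ← mul_assoc, ← mul_assoc, ← hp,
      inv_mul_cancel_right]
  have k2 : (p * w)⁻¹ * B * (p * w) = w'⁻¹ * (r * B * r⁻¹) * w' := by
    rw [k1, mul_inv_rev, inv_inv]
    calc _ = (r⁻¹ * w')⁻¹ * (q * B) * q⁻¹ * (r⁻¹ * w') := by simp only [mul_assoc]
      _ = _ := by rw [← hq.eq]; simp [mul_assoc]
  calc (p * w)⁻¹ * B * (p * w) * A * C * ((p * w)⁻¹ * B * (p * w)) =
      ((p * w)⁻¹ * B * (p * w)) * (A * C) * ((p * w)⁻¹ * B * (p * w)) := by simp only [mul_assoc]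
    _ = (w'⁻¹ * (r * B * r⁻¹) * w') * (C * A) * ((p * w)⁻¹ * B * (p * w)) := by rw [c13'.eq, k2]
    _ = w'⁻¹ * (r * B * r⁻¹) * (w' * C) * (A * w⁻¹) * (p⁻¹ * B * p) * w := by simp [mul_assoc]
    _ = w'⁻¹ * ((r * B * r⁻¹) * C) * (w' * w⁻¹) * (A * (p⁻¹ * B * p)) * w := by
      rw [← hw'.eq, hw.inv_right.eq]; simp only [mul_assoc]
    _ = w'⁻¹ * (E' * (s 2 * s 3)) * q * (s 1 * s 2 * E) * w := by
      rw [m32, m12, hp]; simp [mul_assoc]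
    _ = M := by rw [hx, inv_mul_cancel_right]

end GT

/-- The bracketing `(x₁, x₂), (x₃, x₄)`. -/
abbrev fourPts : BTree := .pair twoPts twoPts

/-- `C` is a bracketing with a hole for the points `k + 1, …, k + 4`; moves and nodes inside the
hole persist. The moves `m₁`, `m₂` lead to a bracketing with brackets around the two middle points,
where `σ_{k+2}` goes to its `λ`-th power, and going back conjugates that value by the two
associators. -/
theorem GT.family_flat_crossing (F : GT) {A : MaxBracketing 8 → (BHat 8 ≃ₜ* BHat 8)}
    (hA : IsBracketingFamily F A) {k : ℕ} (hk : k ≤ 4) (C : BTree → BTree)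
    (hsize : ∀ X, X.size = 4 → (C X).size = 8)
    (hmove : ∀ X X' b b', AMove k X X' b b' → AMove 0 (C X) (C X') b b')
    (hnode : ∀ X j, HasNode k X j → HasNode 0 (C X) j) (h4 : (C fourPts).size = 8) :
    let τ := sigma 8 (k + 2) * sigma 8 (k + 1) * sigma 8 (k + 3) * sigma 8 (k + 2)
    A ⟨C fourPts, h4⟩ τ = ppow τ F.lam := by
  intro τ
  have hs8 := isBraidSeq_sigma 8
  have hs : IsBraidSeq 4 fun i => sigma 8 (k + i) :=
    ⟨fun i j h => hs8.comm _ _ (by omega), fun i h1 h2 => hs8.braid (k + i) (by omega) (by omega)⟩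
  let t₁ : BTree := .pair (.pair twoPts .pt) .pt
  let t₂ : BTree := .pair (.pair .pt twoPts) .pt
  have m₁ : AMove k fourPts t₁ (k + 2, 2) (k, 3) := (AMove.assoc k twoPts .pt .pt).symm
  have m₂ : AMove k t₁ t₂ (k, 2) (k + 1, 2) := AMove.left _ (AMove.assoc k .pt .pt .pt)
  have a₁ := hA.amove ⟨C fourPts, h4⟩ ⟨C t₁, hsize _ rfl⟩ _ _ (hmove _ _ _ _ m₁) (sigma 8 (k + 2))
  have a₂ := hA.amove ⟨C t₁, hsize _ rfl⟩ ⟨C t₂, hsize _ rfl⟩ _ _ (hmove _ _ _ _ m₂)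
    (sigma 8 (k + 2))
  have n₁ := F.family_sigma (by omega) hA ⟨C fourPts, h4⟩ (j := k + 1)
    (hnode _ _ (.inr (.inl (.inl ⟨rfl, rfl, rfl⟩))))
  have n₃ := F.family_sigma (by omega) hA ⟨C fourPts, h4⟩ (j := k + 3)
    (hnode _ _ (.inr (.inr (.inl ⟨rfl, rfl, rfl⟩))))
  have n₂ := F.family_sigma (by omega) hA ⟨C t₂, hsize _ rfl⟩ (j := k + 2)
    (hnode _ _ (.inr (.inl (.inr (.inr (.inl ⟨rfl, rfl, rfl⟩))))))
  simp only [τ, map_mul]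
  refine F.flat_crossing hs (h := ev F.f (fullTwist 8 (k, 2)) (fullTwist 8 (k + 1, 2)) *
    ev F.f (fullTwist 8 (k + 2, 2)) (fullTwist 8 (k, 3))) n₁ n₃ ?_ ?_
  · rw [← n₂, a₂, a₁]
    simp [mul_assoc]
  · have e : twist (fun i => sigma 8 (k + i)) 0 3 = twist (sigma 8) k 3 := by
      simp [twist, ascending, List.range_succ, Nat.add_assoc]
    simp only [fullTwist_eq, twist_two, e, Nat.add_assoc, Nat.reduceAdd]

/-! ### Loops of doubled strands and full twists -/

theorem tau_eq_crossing {i : ℕ} (hi : 1 ≤ i) : tau i = crossing (sigma 8) (2 * i - 2) 2 2 := by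
  obtain ⟨k, rfl⟩ : ∃ k, i = k + 1 := ⟨i - 1, by omega⟩
  simp [tau, crossing, strandCrossing, mul_assoc, Nat.mul_add, Nat.add_assoc]

theorem eta_tau_two : eta tau 2 = crossing (sigma 8) 0 2 2 * crossing (sigma 8) 0 2 2 := by
  simp only [eta, tau_eq_crossing le_rfl, mul_one, Nat.zero_add]

theorem eta_tau_three : eta tau 3 = crossing (sigma 8) 0 2 4 * crossing (sigma 8) 0 4 2 := by
  rw [(isBraidSeq_sigma 8).crossing_add_right 0 2 2 2, crossing_add_left 0 2 2 2,
    show eta tau 3 = tau 2 * (tau 1 * 1 * tau 1) * tau 2 from rfl, tau_eq_crossing le_rfl,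
    tau_eq_crossing (by omega)]
  simp only [mul_one, mul_assoc]

theorem tau_sq {i : ℕ} (hi : 1 ≤ i) (hi3 : i ≤ 3) :
    tau i ^ 2 * (twist (sigma 8) (2 * i - 2) 2 * twist (sigma 8) (2 * i) 2) =
      twist (sigma 8) (2 * i - 2) 4 := by
  rw [tau_eq_crossing hi, sq, (isBraidSeq_sigma 8).twist_add (a := 2) (b := 2) (by omega),
    show 2 * i - 2 + 2 = 2 * i by omega]

namespace GT

variable (F : GT)

/-- The doubled loops fall short of the full twists only by internal twists, which `f` ignores. The
right side is the associator of an A-move between packets of pairs. -/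
theorem ev_eta_tau_two :
    ev F.f (eta tau 2) (tau 2 ^ 2) = ev F.f (twist (sigma 8) 0 4) (twist (sigma 8) 2 4) := by
  have hs := isBraidSeq_sigma 8
  have e := (hs.twist_add (o := 0) (a := 2) (b := 2) (by omega)).symm
  rw [← eta_tau_two] at e
  refine F.ev_congr_central e (tau_sq (by omega) (by omega)) ?_ ?_ ?_ ?_ ?_
  all_goals
    repeat' first | apply Commute.mul_left | apply Commute.mul_right
    all_goals
      first
      | exact hs.twist_commute_twist (by omega) (by omega)
      | exact (hs.twist_commute_twist (by omega) (by omega)).symm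

theorem ev_eta_tau_three :
    ev F.f (eta tau 3) (tau 3 ^ 2) = ev F.f (twist (sigma 8) 0 6) (twist (sigma 8) 4 4) := by
  have hs := isBraidSeq_sigma 8
  have e := (hs.twist_add (o := 0) (a := 4) (b := 2) (by omega)).symm
  rw [← eta_tau_three] at e
  refine F.ev_congr_central e (tau_sq (by omega) (by omega)) ?_ ?_ ?_ ?_ ?_
  all_goals
    repeat' first | apply Commute.mul_left | apply Commute.mul_right
    all_goals
      first
      | exact hs.twist_commute_twist (by omega) (by omega)
      | exact (hs.twist_commute_twist (by omega) (by omega)).symm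

variable {A : MaxBracketing 8 → (BHat 8 ≃ₜ* BHat 8)} (hA : IsBracketingFamily F A)
include hA

/-- The action at the doubled bracketing on the flat crossings is given by Drinfeld's formulas. -/
theorem isDrinfeldAction_tau : IsDrinfeldAction F 4 tau (A doubleBracketing) := by
  refine ⟨?_, fun i h1 h2 => ?_⟩
  · exact F.family_flat_crossing hA (k := 0) (by omega) (fun X => .pair (.pair X twoPts) twoPts)
      (fun X h => by simp [BTree.size, h, twoPts]) (fun _ _ _ _ h => .left _ (.left _ h))
      (fun _ _ h => .inr (.inl (.inr (.inl h)))) rfl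
  · obtain rfl | rfl : i = 2 ∨ i = 3 := by omega
    · have h := F.family_flat_crossing hA (k := 2) (by omega)
        (fun X => .pair (.pair twoPts X) twoPts)
        (fun X h => by simp [BTree.size, h, twoPts]) (fun _ _ _ _ h => .left _ (.right _ h))
        (fun _ _ h => .inr (.inl (.inr (.inr h)))) rfl
      -- This move brackets the second and third pairs together, after which the flat crossing of
      -- these pairs goes to its `λ`-th power.
      have hm := hA.amove doubleBracketing ⟨.pair (.pair twoPts fourPts) twoPts, rfl⟩ (0, 4) (2, 4)
        (AMove.left _ (AMove.assoc 0 twoPts twoPts twoPts)) (tau 2)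
      replace h := hm.symm.trans h
      rw [fullTwist_eq, fullTwist_eq, ← F.ev_eta_tau_two] at h
      rw [← F.inv_ev (eta tau 2), mul_assoc, eq_inv_mul_iff_mul_eq, ← mul_inv_eq_iff_eq_mul]
      exact h
    · have h := F.family_flat_crossing hA (k := 4) (by omega)
        (fun X => .pair fourPts X)
        (fun X h => by simp [BTree.size, h, twoPts]) (fun _ _ _ _ h => .right _ h)
        (fun _ _ h => .inr (.inr h)) rfl
      have hm := hA.amove doubleBracketing ⟨.pair fourPts fourPts, rfl⟩ (0, 6) (4, 4)
        (AMove.assoc 0 fourPts twoPts twoPts) (tau 3)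
      replace h := hm.symm.trans h
      rw [fullTwist_eq, fullTwist_eq, ← F.ev_eta_tau_three] at h
      rw [← F.inv_ev (eta tau 3), mul_assoc, eq_inv_mul_iff_mul_eq, ← mul_inv_eq_iff_eq_mul]
      exact h

/-- Comparison of the doubled bracketing with the standard one. -/
theorem family_doubleBracketing (x : BHat 8) :
    A doubleBracketing x =
      (ev F.f (eta (sigma 8) 3) (sigma 8 3 ^ 2) * ev F.f (eta (sigma 8) 5) (sigma 8 5 ^ 2) *
        ev F.f (eta (sigma 8) 7) (sigma 8 7 ^ 2)) * A (stdBracketing 8) x *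
      (ev F.f (eta (sigma 8) 3) (sigma 8 3 ^ 2) * ev F.f (eta (sigma 8) 5) (sigma 8 5 ^ 2) *
        ev F.f (eta (sigma 8) 7) (sigma 8 7 ^ 2))⁻¹ := by
  have hs := isBraidSeq_sigma 8
  have m₁ := hA.amove (stdBracketing 8)
    ⟨.pair (.pair (.pair (.pair fourPts .pt) .pt) .pt) .pt, rfl⟩ (0, 3) (2, 2)
    (.left _ (.left _ (.left _ (.left _ (.assoc 0 twoPts .pt .pt))))) x
  have m₂ := hA.amove ⟨.pair (.pair (.pair (.pair fourPts .pt) .pt) .pt) .pt, rfl⟩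
    ⟨.pair (.pair (.pair fourPts twoPts) .pt) .pt, rfl⟩ (0, 5) (4, 2)
    (.left _ (.left _ (.assoc 0 fourPts .pt .pt))) x
  have m₃ := hA.amove ⟨.pair (.pair (.pair fourPts twoPts) .pt) .pt, rfl⟩ doubleBracketing
    (0, 7) (6, 2) (.assoc 0 (.pair fourPts twoPts) .pt .pt) x
  simp only [fullTwist_eq, twist_two, Nat.reduceAdd] at m₁ m₂ m₃
  rw [m₃, m₂, m₁, F.ev_eta hs (by omega) (by omega), F.ev_eta hs (by omega) (by omega),
    F.ev_eta hs (by omega) (by omega)]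
  -- The three moves produce the associators in the order `7, 5, 3`; they commute pairwise, so the
  -- order can be reversed.
  have hc : ∀ i j, 1 ≤ i → i + 2 ≤ j → j < 8 →
      Commute (ev F.f (twist (sigma 8) 0 i) (sigma 8 i ^ 2))
        (ev F.f (twist (sigma 8) 0 j) (sigma 8 j ^ 2)) := fun i j h1 h2 h3 =>
    commute_ev_ev _ _ (hs.twist_commute_twist (by omega) (by omega)).symm
      ((hs.twist_commute (by omega) (by omega) (by omega)).pow_right 2)
      (((hs.twist_commute (by omega) (by omega) (by omega)).pow_right 2).symm)
      (((hs.comm i j h2).pow_left 2).pow_right 2)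
  have h35 := hc 3 5 (by omega) (by omega) (by omega)
  have h37 := hc 3 7 (by omega) (by omega) (by omega)
  have h57 := hc 5 7 (by omega) (by omega) (by omega)
  rw [h35.eq, (h57.mul_left h37).eq]
  simp only [mul_inv_rev, mul_assoc]

end GT

/-! ## Doubling the strands -/

theorem exists_doubling : ∃ c : BHat 4 →ₜ* BHat 8, ∀ i, 1 ≤ i → i < 4 → c (sigma 4 i) = tau i := by
  have hs := isBraidSeq_sigma 8
  refine exists_braid_hom (fun i j h1 h2 h3 => ?_) fun i h1 h2 => ?_
  · rw [tau_eq_crossing h1, tau_eq_crossing (by omega)]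
    exact hs.crossing_far (by omega)
  · rw [tau_eq_crossing h1, tau_eq_crossing (by omega), show 2 * (i + 1) - 2 = 2 * i - 2 + 2 by omega]
    exact hs.crossing_braid (by omega)

/-- The homomorphism which replaces every strand by two parallel strands. -/
def doubling : BHat 4 →ₜ* BHat 8 := exists_doubling.choose

theorem doubling_sigma {i : ℕ} (h1 : 1 ≤ i) (h2 : i < 4) : doubling (sigma 4 i) = tau i :=
  exists_doubling.choose_spec i h1 h2

/-- The arrangement of eight packets which keeps one strand from each pair of strands. -/
def oddStrands : Fin 8 → Fin 5 := ![1, 0, 1, 0, 1, 0, 1, 0]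

section

variable [Finite Q] {s : ℕ → Q} {hs : IsBraidSeq 4 s}

theorem isCabling_sigma_of {u u' : Fin 8 → Fin 5} (o a b : ℕ) {i : ℕ} (hi : i + 1 < 8)
    (hN : ∑ p ∈ Finset.range 8, sizes u p ≤ 4) (ho : ∑ p ∈ Finset.range i, sizes u p = o)
    (ha : sizes u i = a) (hb : sizes u (i + 1) = b)
    (hu : u ∘ Equiv.swap ⟨i, by omega⟩ ⟨i + 1, hi⟩ = u') :
    IsCabling hs (sigma 8 (i + 1)) u u' (crossing s o a b) := by
  have := isCabling_sigma (hs := hs) hi hN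
  rwa [packetCrossing, ho, ha, hb, hu] at this

/-- Of the four elementary crossings in a flat crossing, exactly one involves two retained strands
and gives `s i`; a crossing with an empty packet is trivial. -/
theorem isCabling_tau {i : ℕ} (h1 : 1 ≤ i) (h2 : i < 4) :
    IsCabling hs (tau i) oddStrands oddStrands (s i) := by
  obtain rfl | rfl | rfl : i = 1 ∨ i = 2 ∨ i = 3 := by omega
  · have a := isCabling_sigma_of (hs := hs) (u := oddStrands) (u' := ![1, 1, 0, 0, 1, 0, 1, 0]) 1 0 1
      (i := 1) (by decide) (by decide) (by decide) (by decide) (by decide) (by decide)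
    have b := isCabling_sigma_of (hs := hs) (u := ![1, 1, 0, 0, 1, 0, 1, 0])
      (u' := ![1, 1, 0, 0, 1, 0, 1, 0]) 2 0 0
      (i := 2) (by decide) (by decide) (by decide) (by decide) (by decide) (by decide)
    have c := isCabling_sigma_of (hs := hs) (u := ![1, 1, 0, 0, 1, 0, 1, 0])
      (u' := ![1, 1, 0, 0, 1, 0, 1, 0]) 0 1 1
      (i := 0) (by decide) (by decide) (by decide) (by decide) (by decide) (by decide)
    have d := isCabling_sigma_of (hs := hs) (u := ![1, 1, 0, 0, 1, 0, 1, 0])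
      (u' := oddStrands) 1 1 0
      (i := 1) (by decide) (by decide) (by decide) (by decide) (by decide) (by decide)
    simpa [tau, crossing, strandCrossing] using ((d.mul c).mul b).mul a
  · have a := isCabling_sigma_of (hs := hs) (u := oddStrands) (u' := ![1, 0, 1, 1, 0, 0, 1, 0]) 2 0 1
      (i := 3) (by decide) (by decide) (by decide) (by decide) (by decide) (by decide)
    have b := isCabling_sigma_of (hs := hs) (u := ![1, 0, 1, 1, 0, 0, 1, 0])
      (u' := ![1, 0, 1, 1, 0, 0, 1, 0]) 3 0 0
      (i := 4) (by decide) (by decide) (by decide) (by decide) (by decide) (by decide)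
    have c := isCabling_sigma_of (hs := hs) (u := ![1, 0, 1, 1, 0, 0, 1, 0])
      (u' := ![1, 0, 1, 1, 0, 0, 1, 0]) 1 1 1
      (i := 2) (by decide) (by decide) (by decide) (by decide) (by decide) (by decide)
    have d := isCabling_sigma_of (hs := hs) (u := ![1, 0, 1, 1, 0, 0, 1, 0])
      (u' := oddStrands) 2 1 0
      (i := 3) (by decide) (by decide) (by decide) (by decide) (by decide) (by decide)
    simpa [tau, crossing, strandCrossing] using ((d.mul c).mul b).mul a
  · have a := isCabling_sigma_of (hs := hs) (u := oddStrands) (u' := ![1, 0, 1, 0, 1, 1, 0, 0]) 3 0 1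
      (i := 5) (by decide) (by decide) (by decide) (by decide) (by decide) (by decide)
    have b := isCabling_sigma_of (hs := hs) (u := ![1, 0, 1, 0, 1, 1, 0, 0])
      (u' := ![1, 0, 1, 0, 1, 1, 0, 0]) 4 0 0
      (i := 6) (by decide) (by decide) (by decide) (by decide) (by decide) (by decide)
    have c := isCabling_sigma_of (hs := hs) (u := ![1, 0, 1, 0, 1, 1, 0, 0])
      (u' := ![1, 0, 1, 0, 1, 1, 0, 0]) 2 1 1
      (i := 4) (by decide) (by decide) (by decide) (by decide) (by decide) (by decide)
    have d := isCabling_sigma_of (hs := hs) (u := ![1, 0, 1, 0, 1, 1, 0, 0])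
      (u' := oddStrands) 3 1 0
      (i := 5) (by decide) (by decide) (by decide) (by decide) (by decide) (by decide)
    simpa [tau, crossing, strandCrossing] using ((d.mul c).mul b).mul a

theorem IsCabling.inv {n N : ℕ} {s : ℕ → Q} {hs : IsBraidSeq N s} {g : BHat n}
    {u u' : Fin n → Fin (N + 1)} {q : Q} (hg : IsCabling hs g u u' q) :
    IsCabling hs g⁻¹ u' u q⁻¹ := by
  intro x
  rw [show cablingPerm hs g⁻¹ = (cablingPerm hs g)⁻¹ from map_inv (cabling hs n) g,
    Equiv.Perm.inv_eq_iff_eq, hg, mul_inv_cancel_left]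

end

/-- Doubling all strands and forgetting one strand from each pair is the identity. -/
theorem isCabling_doubling [Finite Q] (φ : BHat 4 →ₜ* Q) (x : BHat 4) :
    IsCabling ((isBraidSeq_sigma 4).map (φ : BHat 4 →* Q)) (doubling x) oddStrands oddStrands
      (φ x) := by
  set hs := (isBraidSeq_sigma 4).map (φ : BHat 4 →* Q)
  let H : Subgroup (BHat 4) :=
    { carrier := {y | IsCabling hs (doubling y) oddStrands oddStrands (φ y)}
      one_mem' := by
        change IsCabling hs (doubling 1) _ _ (φ 1)
        rw [map_one, map_one]
        exact isCabling_one
      mul_mem' := fun {y z} hy hz => by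
        change IsCabling hs (doubling (y * z)) _ _ (φ (y * z))
        rw [map_mul, map_mul]
        exact IsCabling.mul hy hz
      inv_mem' := fun {y} hy => by
        change IsCabling hs (doubling y⁻¹) _ _ (φ y⁻¹)
        rw [map_inv, map_inv]
        exact IsCabling.inv hy }
  -- The condition depends on `y` only through its image in a finite discrete product.
  have hcl : IsClosed (H : Set (BHat 4)) := by
    have hc : Continuous fun y : BHat 4 => (cabling hs 8 (doubling y), φ y) :=
      ((map_continuous _).comp (map_continuous doubling)).prodMk (map_continuous φ)
    exact (isClosed_discrete {z : finGrp (Equiv.Perm ((Fin 8 → Fin 5) × Q)) × Q |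
      ∀ x : Q, (show Equiv.Perm ((Fin 8 → Fin 5) × Q) from z.1) (oddStrands, x) =
        (oddStrands, z.2 * x)}).preimage hc
  refine braid_induction (H := H) hcl (fun i h1 h2 => ?_) x
  change IsCabling hs (doubling (sigma 4 i)) _ _ (φ (sigma 4 i))
  rw [doubling_sigma h1 h2]
  exact isCabling_tau h1 h2

/-- If the doubled braid is trivial, so is its cabling by the odd strands, which is `φ x`; this
holds for every homomorphism `φ` to a finite group. -/
theorem doubling_injective : Function.Injective doubling := by
  rw [injective_iff_map_eq_one]
  intro x hx
  apply eq_of_forall_finite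
  intro Q _ φ
  have h := isCabling_doubling φ x
  rw [hx] at h
  rw [map_one]
  exact h.unique isCabling_one

theorem doubling_mem (x : BHat 4) : doubling x ∈ tauSubgroup := by
  have hcl : IsClosed ((tauSubgroup.comap (doubling : BHat 4 →* BHat 8) : Subgroup (BHat 4)) :
      Set (BHat 4)) :=
    (Subgroup.isClosed_topologicalClosure _).preimage (map_continuous doubling)
  refine braid_induction hcl (fun i h1 h2 => ?_) x
  change doubling (sigma 4 i) ∈ tauSubgroup
  rw [doubling_sigma h1 h2]
  apply Subgroup.le_topologicalClosure
  apply Subgroup.subset_closure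
  obtain rfl | rfl | rfl : i = 1 ∨ i = 2 ∨ i = 3 := by omega
  all_goals simp

theorem tauSubgroup_le : tauSubgroup ≤ (doubling : BHat 4 →* BHat 8).range := by
  refine Subgroup.topologicalClosure_minimal _ ?_ (isClosed_range doubling)
  rw [Subgroup.closure_le]
  rintro _ (rfl | rfl | rfl)
  · exact ⟨sigma 4 1, doubling_sigma (by omega) (by omega)⟩
  · exact ⟨sigma 4 2, doubling_sigma (by omega) (by omega)⟩
  · exact ⟨sigma 4 3, doubling_sigma (by omega) (by omega)⟩

/-- The isomorphism of the braid group on four strands with the closed subgroup generated by the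
flat crossings. -/
def doublingEquiv : BHat 4 ≃ₜ* tauSubgroup :=
  equivOfBijective
    (⟨(doubling : BHat 4 →* BHat 8).codRestrict tauSubgroup doubling_mem,
      (map_continuous doubling).subtype_mk _⟩ : BHat 4 →ₜ* tauSubgroup)
    ⟨fun _ _ h => doubling_injective (congrArg Subtype.val h), fun y => by
      obtain ⟨x, hx⟩ := tauSubgroup_le y.2
      exact ⟨x, Subtype.ext hx⟩⟩

/-- Doubling commutes with profinite words and powers and carries `η_i` for the `σ_i` to `η_i` for
the `τ_i`, so the two sets of formulas correspond on generators. -/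
theorem doubling_drinfeld {F : GT} {D : BHat 4 ≃ₜ* BHat 4} {E : BHat 8 ≃ₜ* BHat 8}
    (hD : IsDrinfeldAction F 4 (sigma 4) D) (hE : IsDrinfeldAction F 4 tau E) (x : BHat 4) :
    E (doubling x) = doubling (D x) := by
  have : (toHom E).comp doubling = doubling.comp (toHom D) := by
    refine braid_hom_ext fun i h1 h2 => ?_
    change E (doubling (sigma 4 i)) = doubling (D (sigma 4 i))
    rw [doubling_sigma h1 h2]
    rcases Nat.lt_or_ge 1 i with h | h
    · have he : doubling (eta (sigma 4) i) = eta tau i := by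
        obtain rfl | rfl : i = 2 ∨ i = 3 := by omega
        all_goals simp [eta, doubling_sigma]
      rw [hE.2 i h (by omega), hD.2 i h (by omega)]
      simp only [map_mul, map_ev, map_ppow, map_pow, doubling_sigma h1 h2, he]
    · obtain rfl : i = 1 := by omega
      rw [hE.1, hD.1, map_ppow, doubling_sigma h1 h2]
  exact DFunLike.congr_fun this x

end GTBraid

end

theorem theorem2p4 (F : GTBraid.GT) :
    (∃! A : GTBraid.MaxBracketing 8 → (GTBraid.BHat 8 ≃ₜ* GTBraid.BHat 8),
      GTBraid.IsBracketingFamily F A) ∧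
    ∀ A : GTBraid.MaxBracketing 8 → (GTBraid.BHat 8 ≃ₜ* GTBraid.BHat 8),
      GTBraid.IsBracketingFamily F A →
      -- (i) the subgroup generated by the flat crossings, and the action on it
      (GTBraid.IsDrinfeldAction F 4 GTBraid.tau (A GTBraid.doubleBracketing) ∧
        ∃ (e : GTBraid.BHat 4 ≃ₜ* GTBraid.tauSubgroup)
          (D : GTBraid.BHat 4 ≃ₜ* GTBraid.BHat 4),
          (∀ i : ℕ, 1 ≤ i → i ≤ 3 → (e (GTBraid.sigma 4 i) : GTBraid.BHat 8) = GTBraid.tau i) ∧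
          GTBraid.IsDrinfeldAction F 4 (GTBraid.sigma 4) D ∧
          ∀ x : GTBraid.BHat 4,
            A GTBraid.doubleBracketing (e x : GTBraid.BHat 8) = (e (D x) : GTBraid.BHat 8)) ∧
      -- (ii) comparison with the standard Drinfeld automorphism
      ∀ x : GTBraid.BHat 8,
        A GTBraid.doubleBracketing x =
          (GTBraid.ev F.f (GTBraid.eta (GTBraid.sigma 8) 3) (GTBraid.sigma 8 3 ^ 2) *
            GTBraid.ev F.f (GTBraid.eta (GTBraid.sigma 8) 5) (GTBraid.sigma 8 5 ^ 2) *
            GTBraid.ev F.f (GTBraid.eta (GTBraid.sigma 8) 7) (GTBraid.sigma 8 7 ^ 2)) *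
          A (GTBraid.stdBracketing 8) x *
          (GTBraid.ev F.f (GTBraid.eta (GTBraid.sigma 8) 3) (GTBraid.sigma 8 3 ^ 2) *
            GTBraid.ev F.f (GTBraid.eta (GTBraid.sigma 8) 5) (GTBraid.sigma 8 5 ^ 2) *
            GTBraid.ev F.f (GTBraid.eta (GTBraid.sigma 8) 7) (GTBraid.sigma 8 7 ^ 2))⁻¹ := by
  refine ⟨F.existsUnique_family (by decide), fun A hA => ⟨⟨F.isDrinfeldAction_tau hA, ?_⟩,
    F.family_doubleBracketing hA⟩⟩
  obtain ⟨D, hD⟩ := F.exists_drinfeld (n := 4) (by decide)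
  exact ⟨GTBraid.doublingEquiv, D, fun i h1 h2 => GTBraid.doubling_sigma h1 (by omega), hD,
    GTBraid.doubling_drinfeld hD (F.isDrinfeldAction_tau hA)⟩
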